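/- Let $\Gamma_1,\Gamma_2$ be finitely generated groups such that the free product $\Gamma=\Gamma_1*\Gamma_2$ is non-elementary, that is, both factors are non-trivial and they are not both of order $2$. For a probability measure $\mu$ on $\Gamma$ put $P(x,y)=\mu(x^{-1}y)$, let $P^n$ be its $n$-th power, and let $$R=\Big(\limsup_{n\to\infty}P^n(e,e)^{1/n}\Big)^{-1}.$$ For a subgroup $H\le\Gamma$ let $P_{R,H}$ be the first return kernel to $H$ associated with $R\mu$, that is, for $x,y\in H$, $$P_{R,H}(x,y)=\sum_{n\ge 1}\ \sum_{z_1,\dots,z_{n-1}\in\Gamma\setminus H}R^n\,\mu(x^{-1}z_1)\mu(z_1^{-1}z_2)\cdots\mu(z_{n-1}^{-1}y),$$ and let $R_H(R)=\big(\limsup_{n\to\infty}P_{R,H}^n(e,e)^{1/n}\big)^{-1}$. The measure $\mu$ is called spectrally degenerate along $H$ if $R_H(R)=1$, and spectrally non-degenerate if it is spectrally degenerate along neither of the two free factors $H=\Gamma_1$ and $H=\Gamma_2$. Then there exists a probability measure $\mu$ on $\Gamma$ such that 1. $\mu$ is finitely supported and symmetric ($\mu(g^{-1})=\mu(g)$ for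 all $g\in\Gamma$), and its support generates $\Gamma$ as a semigroup; 2. $\mu$ is adapted: $\mu=\alpha_1\mu_1+\alpha_2\mu_2$ with $\alpha_1,\alpha_2\ge 0$, $\alpha_1+\alpha_2=1$, where each $\mu_i$ is a finitely supported, symmetric probability measure on $\Gamma_i\le\Gamma$ whose support generates $\Gamma_i$ as a semigroup; 3. $\mu$ is spectrally non-degenerate. -/

import Mathlib

open Filter
open scoped ENNReal

noncomputable section

namespace RatioLimit

/-- The `n`-th power of a non-negative kernel `K` on a set `X`. -/
def kernelPow {X : Type*} (K : X → X → ℝ≥0∞) : ℕ → X → X → ℝ≥0∞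
  | 0 => fun x y => Set.indicator {x} (fun _ => 1) y
  | n + 1 => fun x y => ∑' z, K x z * kernelPow K n z y

/-- The spectral radius `limsup_n (Kⁿ(x, y))^{1/n}` of a non-negative kernel, read off at the
pair `(x, y)` (for an irreducible kernel the value does not depend on this pair). -/
def kernelSpectralRadius {X : Type*} (K : X → X → ℝ≥0∞) (x y : X) : ℝ≥0∞ :=
  limsup (fun n : ℕ => kernelPow K n x y ^ (1 / (n : ℝ))) atTop

section Group

variable {G : Type*} [Group G]

/-- `μ` is symmetric: `μ(g⁻¹) = μ(g)`. -/
def IsSymmetric (μ : PMF G) : Prop := ∀ g : G, μ g⁻¹ = μ g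

/-- `μ` is finitely supported. -/
def IsFinitelySupported (μ : PMF G) : Prop := μ.support.Finite

/-- `μ` is admissible: its support generates `G` as a semigroup. -/
def IsAdmissible (μ : PMF G) : Prop := Subsemigroup.closure μ.support = ⊤

/-- The transition kernel `P(x, y) = μ(x⁻¹ y)` of the random walk driven by `μ`. -/
def walkKernel (μ : PMF G) (x y : G) : ℝ≥0∞ := μ (x⁻¹ * y)

/-- `R`, the inverse of the spectral radius of the random walk driven by `μ`. -/
def walkR (μ : PMF G) : ℝ≥0∞ := (kernelSpectralRadius (walkKernel μ) 1 1)⁻¹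

/-- `∑_{z₁, …, zₙ ∉ H} μ(x⁻¹z₁) μ(z₁⁻¹z₂) ⋯ μ(zₙ⁻¹y)`: the weight of the paths of `n + 1` steps
from `x` to `y` whose `n` intermediate points all avoid `H`. -/
def avoidingWeight (μ : PMF G) (H : Subgroup G) : ℕ → G → G → ℝ≥0∞
  | 0 => fun x y => walkKernel μ x y
  | n + 1 => fun x y => ∑' z : {z : G // z ∉ H}, walkKernel μ x z * avoidingWeight μ H n z y

/-- The first return kernel `P_{r,H}` to `H` associated with the measure `r μ`. -/
def firstReturnKernel (μ : PMF G) (r : ℝ≥0∞) (H : Subgroup G) (x y : H) : ℝ≥0∞ :=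
  ∑' n : ℕ, r ^ (n + 1) * avoidingWeight μ H n x y

/-- `R_H(r)`, the inverse of the spectral radius of `P_{r,H}`. -/
def returnR (μ : PMF G) (H : Subgroup G) (r : ℝ≥0∞) : ℝ≥0∞ :=
  (kernelSpectralRadius (firstReturnKernel μ r H) 1 1)⁻¹

/-- `μ` is spectrally degenerate along `H`: `R_H(R) = 1`. -/
def IsSpectrallyDegenerateAlong (μ : PMF G) (H : Subgroup G) : Prop :=
  returnR μ H (walkR μ) = 1

/-- `μ` is spectrally non-degenerate with respect to the collection `Ω` of subgroups. -/
def IsSpectrallyNonDegenerate (μ : PMF G) (Ω : Set (Subgroup G)) : Prop :=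
  ∀ H ∈ Ω, ¬ IsSpectrallyDegenerateAlong μ H

end Group

/-- The free product `Γ₁ * Γ₂` is non-elementary: both factors are non-trivial and they are not
both of order two. -/
def IsNonElementaryFreeProduct (Γ₁ Γ₂ : Type*) [Group Γ₁] [Group Γ₂] : Prop :=
  Nontrivial Γ₁ ∧ Nontrivial Γ₂ ∧ ¬ (Nat.card Γ₁ = 2 ∧ Nat.card Γ₂ = 2)

/-- The parabolic subgroups `Γ₁` and `Γ₂` of the free product `Γ₁ * Γ₂`. -/
def freeFactors (Γ₁ Γ₂ : Type*) [Group Γ₁] [Group Γ₂] : Set (Subgroup (Monoid.Coprod Γ₁ Γ₂)) :=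
  {(Monoid.Coprod.inl : Γ₁ →* Monoid.Coprod Γ₁ Γ₂).range,
    (Monoid.Coprod.inr : Γ₂ →* Monoid.Coprod Γ₁ Γ₂).range}

/-- `μ = α₁ μ₁ + α₂ μ₂`, where `μᵢ` is regarded as a measure on the free product. -/
def IsConvexCombination {Γ₁ Γ₂ : Type*} [Group Γ₁] [Group Γ₂] (μ : PMF (Monoid.Coprod Γ₁ Γ₂))
    (α₁ α₂ : ℝ≥0∞) (μ₁ : PMF Γ₁) (μ₂ : PMF Γ₂) : Prop :=
  α₁ + α₂ = 1 ∧ ∀ g : Monoid.Coprod Γ₁ Γ₂,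
    μ g = α₁ * μ₁.map Monoid.Coprod.inl g + α₂ * μ₂.map Monoid.Coprod.inr g

/-- `μ` is adapted to the free product, with finitely supported, admissible and symmetric
probability measures on the two factors. -/
def IsAdapted {Γ₁ Γ₂ : Type*} [Group Γ₁] [Group Γ₂] (μ : PMF (Monoid.Coprod Γ₁ Γ₂)) : Prop :=
  ∃ (α₁ α₂ : ℝ≥0∞) (μ₁ : PMF Γ₁) (μ₂ : PMF Γ₂),
    IsFinitelySupported μ₁ ∧ IsAdmissible μ₁ ∧ IsSymmetric μ₁ ∧
    IsFinitelySupported μ₂ ∧ IsAdmissible μ₂ ∧ IsSymmetric μ₂ ∧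
    IsConvexCombination μ α₁ α₂ μ₁ μ₂

end RatioLimit

end

open Filter
open scoped ENNReal

noncomputable section

namespace RatioLimit

/-! For each factor fix `z i < 1` and let `F i` be the Green function of `μᵢ` at `z i`, normalised
to be `1` at the identity; `U i < 1` is its return generating function. Let `φ` be the product of
the `F`-values of the letters of a reduced word. A step of an adapted walk changes only one end of
the word. If `r₀ * α i = c i * z i`, then at a word whose end letter lies in factor `i` the operator
`r₀ P` multiplies `φ` by `c i + c (!i) * U (!i)`. The weights `α` are chosen in
`exists_coefficients` so that this number is `1` for both `i`, hence `r₀ P φ = φ` away from the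
identity.

The parameters `z` place `φ` just outside `ℓ²`. With `Aᵢ = ∑_{x ≠ 1} F i x ^ 2`, the mass of `φ²` on
spheres is multiplied by `A₁ A₂` when the radius grows by two, so `A₁ A₂ = 1` keeps it constant
along positive even radii. Truncations `f` of `φ` to balls then satisfy `‖f‖² ≤ r₀ ⟨f, P f⟩ + C`
with `C` fixed and `‖f‖ → ∞`. This forces the spectral radius of `P` to be at least `1 / r₀`, that
is `R ≤ r₀` (`walkR_le_core`).

For non-degeneracy along factor `i`, replace the weight of the letter at the other end of the word
by `1` when it lies in that factor. The new function is `1` on the subgroup and still fixed by `r₀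
P` off it, while on the subgroup `r₀ P` gives `c i * z i + c (!i) * U (!i)`, which is less than `1`
because `z i < 1`. It dominates the row sums of the first return kernel, so `R_H(R) > 1`
(`not_degenerate_factor`).

It remains to arrange `A₁ A₂ = 1`. Concentrating `μᵢ` on one or two elements and taking `z` near `1`
makes `Aᵢ` at least `8/10` for a non-trivial group and at least `13/10` if the group has three
elements; this is where non-elementarity enters. As `Aᵢ` is continuous in `z` and vanishes at `0`,
the values `13/10` and `10/13` are attained (`exists_hittingSum_eq`). -/

theorem ennreal_two_mul_le_add_sq (a b : ℝ≥0∞) : 2 * (a * b) ≤ a ^ 2 + b ^ 2 := by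
  wlog h : a ≤ b generalizing a b
  · rw [mul_comm a b, add_comm]; exact this b a (le_of_not_ge h)
  obtain ⟨c, rfl⟩ := exists_add_of_le h
  calc 2 * (a * (a + c)) ≤ 2 * (a * (a + c)) + c ^ 2 := le_self_add
    _ = a ^ 2 + (a + c) ^ 2 := by ring

/-- Cauchy–Schwarz without any summability assumption: sum `2ab ≤ a² + b²` over all pairs with `a =
f x * g y` and `b = f y * g x`. -/
theorem ennreal_tsum_mul_sq_le {X : Type*} (f g : X → ℝ≥0∞) :
    (∑' x, f x * g x) ^ 2 ≤ (∑' x, f x ^ 2) * ∑' x, g x ^ 2 := by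
  have key : 2 * (∑' x, f x * g x) ^ 2 ≤ 2 * ((∑' x, f x ^ 2) * ∑' x, g x ^ 2) := by
    calc 2 * (∑' x, f x * g x) ^ 2
        = ∑' x, ∑' y, 2 * ((f x * g y) * (f y * g x)) := by
          rw [sq, ← ENNReal.tsum_mul_right, ← ENNReal.tsum_mul_left]
          refine tsum_congr fun x => ?_
          rw [← ENNReal.tsum_mul_left, ← ENNReal.tsum_mul_left]
          exact tsum_congr fun y => by ring
      _ ≤ ∑' x, ∑' y, ((f x * g y) ^ 2 + (f y * g x) ^ 2) :=
          ENNReal.tsum_le_tsum fun x => ENNReal.tsum_le_tsum fun y =>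
            ennreal_two_mul_le_add_sq _ _
      _ = 2 * ((∑' x, f x ^ 2) * ∑' x, g x ^ 2) := by
          simp_rw [ENNReal.tsum_add, mul_pow, ENNReal.tsum_mul_left, ENNReal.tsum_mul_right,
            ENNReal.tsum_mul_left]
          ring
  exact (ENNReal.mul_le_mul_iff_right (by simp) (by simp)).1 key

/-! ### Powers of a kernel, and quadratic forms of symmetric kernels against the spectral radius -/

section Kernel

variable {X : Type*} (K : X → X → ℝ≥0∞)

theorem tsum_kernelPow_zero_mul (x : X) (f : X → ℝ≥0∞) :
    ∑' y, kernelPow K 0 x y * f y = f x := by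
  rw [tsum_eq_single x]
  · simp [kernelPow]
  · intro y hy; simp [kernelPow, hy]

theorem kernelPow_add (m n : ℕ) (x y : X) :
    kernelPow K (m + n) x y = ∑' z, kernelPow K m x z * kernelPow K n z y := by
  induction m generalizing x with
  | zero => rw [tsum_kernelPow_zero_mul, Nat.zero_add]
  | succ m ih =>
    rw [Nat.succ_add]
    simp only [kernelPow, ih, ← ENNReal.tsum_mul_left, ← ENNReal.tsum_mul_right]
    rw [ENNReal.tsum_comm]
    exact tsum_congr fun z => tsum_congr fun w => by ring

theorem kernelPow_one (x y : X) : kernelPow K 1 x y = K x y := by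
  simp only [kernelPow]
  rw [tsum_eq_single y]
  · simp
  · intro z hz; simp [hz.symm]

theorem kernelPow_succ_right (n : ℕ) (x y : X) :
    kernelPow K (n + 1) x y = ∑' z, kernelPow K n x z * K z y := by
  simp_rw [kernelPow_add K n 1 x y, kernelPow_one]

theorem kernelPow_symm (hK : ∀ x y, K x y = K y x) (n : ℕ) (x y : X) :
    kernelPow K n x y = kernelPow K n y x := by
  induction n generalizing x y with
  | zero =>
    by_cases h : x = y
    · rw [h]
    · simp [kernelPow, h, Ne.symm h]
  | succ n ih =>
    rw [kernelPow_succ_right, kernelPow]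
    refine tsum_congr fun z => ?_
    rw [ih x z, hK z y, mul_comm]

theorem tsum_kernelPow_le {m : ℝ≥0∞} (hK : ∀ x, ∑' y, K x y ≤ m) (n : ℕ) (x : X) :
    ∑' y, kernelPow K n x y ≤ m ^ n := by
  induction n generalizing x with
  | zero => simpa using (tsum_kernelPow_zero_mul K x fun _ => 1).le
  | succ n ih =>
    simp only [kernelPow]
    rw [ENNReal.tsum_comm]
    calc ∑' z, ∑' y, K x z * kernelPow K n z y = ∑' z, K x z * ∑' y, kernelPow K n z y := by
          simp_rw [ENNReal.tsum_mul_left]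
      _ ≤ ∑' z, K x z * m ^ n := ENNReal.tsum_le_tsum fun z => mul_le_mul_right (ih z) _
      _ ≤ m ^ (n + 1) := by
          rw [ENNReal.tsum_mul_right, pow_succ']
          exact mul_le_mul_left (hK x) _

theorem kernelSpectralRadius_le {m : ℝ≥0∞} (hK : ∀ x, ∑' y, K x y ≤ m) (x y : X) :
    kernelSpectralRadius K x y ≤ m := by
  refine limsup_le_of_le (by isBoundedDefault) ?_
  filter_upwards [eventually_gt_atTop 0] with n hn
  have h : kernelPow K n x y ≤ m ^ n := (ENNReal.le_tsum y).trans (tsum_kernelPow_le K hK n x)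
  calc kernelPow K n x y ^ (1 / (n : ℝ)) ≤ (m ^ n) ^ (1 / (n : ℝ)) :=
        ENNReal.rpow_le_rpow h (by positivity)
    _ = m := by
        rw [one_div]; exact ENNReal.pow_rpow_inv_natCast hn.ne' m

/-- The quadratic form `⟨f, Kⁿ f⟩`. -/
def quadForm (f : X → ℝ≥0∞) (n : ℕ) : ℝ≥0∞ := ∑' x, f x * ∑' y, kernelPow K n x y * f y

theorem quadForm_zero (f : X → ℝ≥0∞) : quadForm K f 0 = ∑' x, f x ^ 2 := by
  simp_rw [quadForm, tsum_kernelPow_zero_mul, sq]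

theorem quadForm_add_self (hK : ∀ x y, K x y = K y x) (f : X → ℝ≥0∞) (n : ℕ) :
    quadForm K f (n + n) = ∑' x, (∑' y, kernelPow K n x y * f y) ^ 2 := by
  calc quadForm K f (n + n)
      = ∑' x, ∑' y, ∑' z, f x * kernelPow K n z x * (kernelPow K n z y * f y) := by
        refine tsum_congr fun x => ?_
        rw [← ENNReal.tsum_mul_left]
        refine tsum_congr fun y => ?_
        rw [kernelPow_add, ← ENNReal.tsum_mul_right, ← ENNReal.tsum_mul_left]
        refine tsum_congr fun z => ?_
        rw [kernelPow_symm K hK n x z]; ring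
    _ = ∑' x, ∑' z, ∑' y, f x * kernelPow K n z x * (kernelPow K n z y * f y) :=
        tsum_congr fun x => ENNReal.tsum_comm
    _ = ∑' z, ∑' x, ∑' y, f x * kernelPow K n z x * (kernelPow K n z y * f y) :=
        ENNReal.tsum_comm
    _ = _ := by
        refine tsum_congr fun z => ?_
        simp_rw [ENNReal.tsum_mul_left, ENNReal.tsum_mul_right, sq]
        congr 1
        exact tsum_congr fun x => mul_comm _ _

theorem quadForm_sq_le (hK : ∀ x y, K x y = K y x) (f : X → ℝ≥0∞) (n : ℕ) :
    quadForm K f n ^ 2 ≤ quadForm K f 0 * quadForm K f (n + n) := by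
  rw [quadForm_add_self K hK, quadForm_zero]
  exact ennreal_tsum_mul_sq_le _ _

/-- Iterated Cauchy–Schwarz: each doubling of the exponent costs one application of
`quadForm_sq_le`. -/
theorem quadForm_pow_two_pow_le (hK : ∀ x y, K x y = K y x) (f : X → ℝ≥0∞) (j : ℕ) :
    quadForm K f 1 ^ 2 ^ j ≤ quadForm K f 0 ^ (2 ^ j - 1) * quadForm K f (2 ^ j) := by
  induction j with
  | zero => simp
  | succ j ih =>
    have e : 2 ^ (j + 1) - 1 = (2 ^ j - 1) * 2 + 1 := by
      have := Nat.one_le_two_pow (n := j); rw [pow_succ]; omega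
    calc quadForm K f 1 ^ 2 ^ (j + 1) = (quadForm K f 1 ^ 2 ^ j) ^ 2 := by
          rw [← pow_mul, pow_succ]
      _ ≤ (quadForm K f 0 ^ (2 ^ j - 1) * quadForm K f (2 ^ j)) ^ 2 := by gcongr
      _ = quadForm K f 0 ^ ((2 ^ j - 1) * 2) * quadForm K f (2 ^ j) ^ 2 := by
          rw [mul_pow, ← pow_mul]
      _ ≤ quadForm K f 0 ^ ((2 ^ j - 1) * 2) *
            (quadForm K f 0 * quadForm K f (2 ^ j + 2 ^ j)) := by
          gcongr; exact quadForm_sq_le K hK f _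
      _ = _ := by
          rw [e, pow_succ (quadForm K f 0) ((2 ^ j - 1) * 2), mul_assoc, pow_succ 2 j,
            mul_two (2 ^ j)]

/-- By Cauchy–Schwarz an even power of a symmetric kernel is largest on the diagonal, which is
constant here. -/
theorem kernelPow_add_self_le (hK : ∀ x y, K x y = K y x) {x₀ : X} {n : ℕ}
    (hd : ∀ x, kernelPow K (n + n) x x = kernelPow K (n + n) x₀ x₀) (x y : X) :
    kernelPow K (n + n) x y ≤ kernelPow K (n + n) x₀ x₀ := by
  have hs : ∀ x, ∑' z, kernelPow K n x z ^ 2 = kernelPow K (n + n) x₀ x₀ := fun x => by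
    rw [← hd x, kernelPow_add]
    exact tsum_congr fun z => by rw [kernelPow_symm K hK n z x, sq]
  have h := ennreal_tsum_mul_sq_le (kernelPow K n x) (kernelPow K n y)
  rw [hs, hs, ← sq] at h
  have h' := (ENNReal.pow_le_pow_left_iff two_ne_zero).1 h
  rw [kernelPow_add]
  refine le_trans (le_of_eq ?_) h'
  exact tsum_congr fun z => by rw [kernelPow_symm K hK n z y]

/-- This replaces the spectral theorem: the return probabilities at one point control the quadratic
form. If `⟨f, K f⟩` exceeded `q ⟨f, f⟩`, then `⟨f, K^(2^j) f⟩` would outgrow every multiple of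
`q^(2^j)`. But `f` is in `ℓ¹`, so this form is at most `(∑ f)²` times the diagonal value of
`K^(2^j)`, eventually at most `q^(2^j)`. -/
theorem quadForm_one_le (hK : ∀ x y, K x y = K y x) {x₀ : X}
    (hd : ∀ n x, kernelPow K n x x = kernelPow K n x₀ x₀) (f : X → ℝ≥0∞)
    (hf : ∑' x, f x ≠ ∞) {q : ℝ≥0∞} (hq : kernelSpectralRadius K x₀ x₀ < q) :
    quadForm K f 1 ≤ quadForm K f 0 * q := by
  set B := ∑' x, f x with hB
  have hM : ∀ n : ℕ, quadForm K f (n + n) ≤ B ^ 2 * kernelPow K (n + n) x₀ x₀ := fun n => by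
    calc quadForm K f (n + n) ≤ ∑' x, f x * ∑' y, kernelPow K (n + n) x₀ x₀ * f y := by
          refine ENNReal.tsum_le_tsum fun x => mul_le_mul_right
            (ENNReal.tsum_le_tsum fun y => mul_le_mul_left ?_ _) _
          exact kernelPow_add_self_le K hK (hd _) x y
      _ = B ^ 2 * kernelPow K (n + n) x₀ x₀ := by
          rw [ENNReal.tsum_mul_left, ENNReal.tsum_mul_right, ← hB]; ring
  have hM0 : quadForm K f 0 ≠ ∞ := by
    have h := hM 0
    simp only [kernelPow, Nat.add_zero, Set.mem_singleton_iff, Set.indicator_of_mem] at h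
    exact ne_top_of_le_ne_top (by finiteness) h
  rcases eq_or_ne (quadForm K f 0) 0 with h0 | h0
  · have h := quadForm_sq_le K hK f 1
    rw [h0, zero_mul] at h
    rw [pow_eq_zero_iff two_ne_zero |>.1 (le_antisymm h zero_le)]
    exact zero_le
  rcases eq_or_ne q ∞ with rfl | hq'
  · rw [ENNReal.mul_top h0]; exact le_top
  have hq0 : q ≠ 0 := (lt_of_le_of_lt zero_le hq).ne'
  by_contra! hlt
  set t := quadForm K f 1 / (quadForm K f 0 * q) with ht
  have hden : quadForm K f 0 * q ≠ 0 := mul_ne_zero h0 hq0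
  have hden' : quadForm K f 0 * q ≠ ∞ := ENNReal.mul_ne_top hM0 hq'
  have ht1 : 1 < t := by
    rw [ht, ENNReal.lt_div_iff_mul_lt (Or.inl hden) (Or.inl hden'), one_mul]; exact hlt
  have htend : Tendsto (fun j : ℕ => t ^ 2 ^ j) atTop (nhds ∞) :=
    (ENNReal.tendsto_pow_atTop_nhds_top_iff.2 ht1).comp
      (tendsto_pow_atTop_atTop_of_one_lt one_lt_two)
  have hC : B ^ 2 / quadForm K f 0 < ∞ := ENNReal.div_lt_top (by finiteness) h0
  have hev := (eventually_lt_of_limsup_lt hq).and (eventually_gt_atTop 0)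
  have hev2 := (tendsto_pow_atTop_atTop_of_one_lt one_lt_two).eventually hev
  -- `0 < j` makes `2 ^ j` even, as the diagonal bound `hM` requires.
  obtain ⟨j, ⟨⟨hj1, -⟩, hj2⟩, hj3⟩ :=
    ((hev2.and (htend.eventually (lt_mem_nhds hC))).and (eventually_gt_atTop 0)).exists
  have hn : (2 ^ j : ℕ) ≠ 0 := by positivity
  have hk : kernelPow K (2 ^ j) x₀ x₀ ≤ q ^ 2 ^ j := by
    calc kernelPow K (2 ^ j) x₀ x₀
        = (kernelPow K (2 ^ j) x₀ x₀ ^ (1 / ((2 ^ j : ℕ) : ℝ))) ^ (2 ^ j) := by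
          rw [one_div, ENNReal.rpow_inv_natCast_pow hn]
      _ ≤ _ := by gcongr
  refine absurd hj2 (not_lt.2 ?_)
  have h2 : quadForm K f (2 ^ j) ≤ B ^ 2 * q ^ 2 ^ j := by
    obtain ⟨i, rfl⟩ := Nat.exists_eq_succ_of_ne_zero hj3.ne'
    have e : 2 ^ (i + 1) = 2 ^ i + 2 ^ i := by rw [pow_succ, mul_two]
    have := hM (2 ^ i)
    rw [← e] at this
    exact this.trans (mul_le_mul_right hk _)
  have hden2 : (quadForm K f 0 * q) ^ 2 ^ j ≠ 0 := pow_ne_zero _ hden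
  have hden3 : (quadForm K f 0 * q) ^ 2 ^ j ≠ ∞ := ENNReal.pow_ne_top hden'
  rw [ht, div_eq_mul_inv, mul_pow, ← ENNReal.inv_pow, ← div_eq_mul_inv,
    ENNReal.le_div_iff_mul_le (Or.inl h0) (Or.inl hM0), mul_comm, ← mul_div_assoc]
  refine ENNReal.div_le_of_le_mul ?_
  calc quadForm K f 0 * quadForm K f 1 ^ 2 ^ j
      ≤ quadForm K f 0 * (quadForm K f 0 ^ (2 ^ j - 1) * (B ^ 2 * q ^ 2 ^ j)) := by
        gcongr
        exact (quadForm_pow_two_pow_le K hK f j).trans (mul_le_mul_right h2 _)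
    _ = B ^ 2 * (quadForm K f 0 * q) ^ 2 ^ j := by
        rw [← mul_assoc, ← pow_succ', Nat.sub_add_cancel (Nat.one_le_iff_ne_zero.2 hn), mul_pow]
        ring

end Kernel

/-! ### Two criteria for random walks: an upper bound for `R`, and spectral non-degeneracy -/

section Walk

variable {G : Type*} [Group G] (μ : PMF G)

theorem tsum_walkKernel_mul (f : G → ℝ≥0∞) (x : G) :
    ∑' y, walkKernel μ x y * f y = ∑' g, μ g * f (x * g) := by
  rw [← (Equiv.mulLeft x).tsum_eq]
  simp [walkKernel]

theorem walkKernel_symm {μ : PMF G} (hμ : IsSymmetric μ) (x y : G) :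
    walkKernel μ x y = walkKernel μ y x := by
  rw [walkKernel, walkKernel, ← hμ]; simp

theorem kernelPow_walkKernel_mul_left (n : ℕ) (g x y : G) :
    kernelPow (walkKernel μ) n (g * x) (g * y) = kernelPow (walkKernel μ) n x y := by
  induction n generalizing x y with
  | zero => by_cases h : y = x <;> simp [kernelPow, h]
  | succ n ih =>
    simp only [kernelPow]
    rw [← (Equiv.mulLeft g).tsum_eq]
    refine tsum_congr fun z => ?_
    rw [Equiv.coe_mulLeft, ih]
    simp [walkKernel, mul_assoc]

/-- If the spectral radius were below some `q` with `r₀ * q < 1`, then `‖f‖² ≤ r₀ q ‖f‖² + C` would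
bound `‖f‖²` by `C / (1 - r₀ q)`, uniformly in `N`. -/
theorem walkR_le_of_quadForm {μ : PMF G} (hμ : IsSymmetric μ) {r₀ : ℝ≥0∞} (h0 : r₀ ≠ 0)
    (htop : r₀ ≠ ∞) (f : ℕ → G → ℝ≥0∞) (hf : ∀ N, ∑' x, f N x ≠ ∞) {C : ℝ≥0∞} (hC : C ≠ ∞)
    (hle : ∀ N, ∑' x, f N x ^ 2 ≤ r₀ * ∑' x, f N x * ∑' g, μ g * f N (x * g) + C)
    (hlim : Tendsto (fun N => ∑' x, f N x ^ 2) atTop (nhds ∞)) : walkR μ ≤ r₀ := by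
  rw [walkR, ENNReal.inv_le_iff_inv_le]
  by_contra! hlt
  obtain ⟨q, hq1, hq2⟩ := exists_between hlt
  have hrq : r₀ * q < 1 := by
    rw [mul_comm]
    exact (ENNReal.lt_div_iff_mul_lt (Or.inl h0) (Or.inl htop)).1 (by simpa using hq2)
  have hb : ∀ N, ∑' x, f N x ^ 2 ≤ C / (1 - r₀ * q) := fun N => by
    -- `ℓ¹` embeds in `ℓ²`; finiteness is needed for the subtraction in `ℝ≥0∞`.
    have hfin : ∑' x, f N x ^ 2 ≠ ∞ := by
      refine ne_top_of_le_ne_top (ENNReal.pow_ne_top (n := 2) (hf N)) ?_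
      rw [sq, ← ENNReal.tsum_mul_right]
      refine ENNReal.tsum_le_tsum fun x => ?_
      rw [sq]
      exact mul_le_mul_right (ENNReal.le_tsum x) _
    have h1 := quadForm_one_le (walkKernel μ) (walkKernel_symm hμ) (x₀ := 1)
      (fun n x => by simpa using kernelPow_walkKernel_mul_left μ n x 1 1) (f N) (hf N) hq1
    rw [quadForm_zero] at h1
    simp_rw [quadForm, kernelPow_one, tsum_walkKernel_mul] at h1
    have h2 := (hle N).trans (add_le_add_left (mul_le_mul_right h1 r₀) C)
    rw [ENNReal.le_div_iff_mul_le (Or.inl (tsub_pos_of_lt hrq).ne') (Or.inl (by finiteness)),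
      ENNReal.mul_sub fun _ _ => hfin, mul_one]
    rw [tsub_le_iff_left]
    refine h2.trans (le_of_eq ?_)
    ring
  have hCt : C / (1 - r₀ * q) < ∞ := ENNReal.div_lt_top hC (tsub_pos_of_lt hrq).ne'
  obtain ⟨N, hN⟩ := (hlim.eventually (lt_mem_nhds hCt)).exists
  exact absurd (hb N) (not_le.2 hN)

/-- A function that is `1` on `H` and superharmonic off `H` dominates the generating function of the
first hit of `H`. Split at the first step: landing in `H` contributes `φ = 1`, landing at `z ∉ H`
contributes at most `φ z` by induction. -/
theorem sum_range_avoidingWeight_le (H : Subgroup G) {r : ℝ≥0∞} (φ : G → ℝ≥0∞)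
    (hφ : ∀ x ∈ H, φ x = 1) (hoff : ∀ x ∉ H, r * ∑' g, μ g * φ (x * g) ≤ φ x) (N : ℕ) (x : G) :
    ∑ n ∈ Finset.range N, r ^ (n + 1) * ∑' y : H, avoidingWeight μ H n x y ≤
      r * ∑' g, μ g * φ (x * g) := by
  induction N generalizing x with
  | zero => simp
  | succ N ih =>
    rw [Finset.sum_range_succ']
    have e : ∀ n, ∑' y : H, avoidingWeight μ H (n + 1) x y =
        ∑' z : {z : G // z ∉ H}, walkKernel μ x z * ∑' y : H, avoidingWeight μ H n z y := by
      intro n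
      simp only [avoidingWeight]
      rw [ENNReal.tsum_comm]
      simp_rw [ENNReal.tsum_mul_left]
    have h1 : ∑ n ∈ Finset.range N, r ^ (n + 1 + 1) * ∑' y : H, avoidingWeight μ H (n + 1) x y ≤
        r * ∑' z : {z : G // z ∉ H}, walkKernel μ x z * φ z := by
      calc _ = r * ∑' z : {z : G // z ∉ H}, walkKernel μ x z *
            ∑ n ∈ Finset.range N, r ^ (n + 1) * ∑' y : H, avoidingWeight μ H n z y := by
            simp_rw [e, Finset.mul_sum]
            rw [Summable.tsum_finsetSum fun _ _ => ENNReal.summable, Finset.mul_sum]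
            refine Finset.sum_congr rfl fun n _ => ?_
            rw [← ENNReal.tsum_mul_left, ← ENNReal.tsum_mul_left]
            exact tsum_congr fun z => by ring
        _ ≤ _ := by
            gcongr with z
            exact (ih z).trans (hoff z z.2)
    have h2 : ∑' y : H, avoidingWeight μ H 0 x y = ∑' y : H, walkKernel μ x y * φ y :=
      tsum_congr fun y => by rw [hφ y y.2, mul_one, avoidingWeight]
    rw [h2, zero_add, pow_one, ← tsum_walkKernel_mul]
    refine (add_le_add_left h1 _).trans (le_of_eq ?_)
    rw [← mul_add, add_comm]
    congr 1
    exact ENNReal.summable.tsum_add_tsum_compl (s := (H : Set G))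
      (f := fun y => walkKernel μ x y * φ y) ENNReal.summable

theorem not_isSpectrallyDegenerateAlong {μ : PMF G} {H : Subgroup G} {r₀ m : ℝ≥0∞}
    (hR : walkR μ ≤ r₀) (hm : m < 1) (φ : G → ℝ≥0∞) (hφ : ∀ x ∈ H, φ x = 1)
    (hoff : ∀ x ∉ H, r₀ * ∑' g, μ g * φ (x * g) ≤ φ x)
    (hon : ∀ x ∈ H, r₀ * ∑' g, μ g * φ (x * g) ≤ m) : ¬ IsSpectrallyDegenerateAlong μ H := by
  have hK : ∀ x : H, ∑' y, firstReturnKernel μ (walkR μ) H x y ≤ m := fun x => by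
    simp only [firstReturnKernel]
    rw [ENNReal.tsum_comm]
    simp_rw [ENNReal.tsum_mul_left]
    rw [ENNReal.tsum_eq_iSup_nat]
    refine iSup_le fun N => ?_
    refine le_trans ?_ ((sum_range_avoidingWeight_le μ H φ hφ hoff N x).trans (hon x x.2))
    gcongr
  have h := (kernelSpectralRadius_le _ hK 1 1).trans_lt hm
  rw [IsSpectrallyDegenerateAlong, returnR, ENNReal.inv_eq_one]
  exact h.ne

end Walk

/-! ### Multiplicative weights on reduced words and their sums over spheres -/

section Words

open Monoid CoprodI

variable {M : Bool → Type*}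

/-- The product of the weights `γ` of the letters of a list. -/
def letterProd (γ : ∀ i, M i → ℝ≥0∞) (l : List (Σ i, M i)) : ℝ≥0∞ :=
  (l.map fun a => γ a.1 a.2).prod

/-- The product of the weights `F` of all letters but the last one, which has the weight `c`. -/
def letterProdLast (F c : ∀ i, M i → ℝ≥0∞) : List (Σ i, M i) → ℝ≥0∞
  | [] => 1
  | [a] => c a.1 a.2
  | a :: b :: l => F a.1 a.2 * letterProdLast F c (b :: l)

theorem letterProd_sq (γ : ∀ i, M i → ℝ≥0∞) (l : List (Σ i, M i)) :
    letterProd (fun i a => γ i a ^ 2) l = letterProd γ l ^ 2 := by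
  simp only [letterProd]
  induction l with
  | nil => simp
  | cons a l ih => simp [ih, mul_pow]

theorem letterProdLast_self (F : ∀ i, M i → ℝ≥0∞) (l : List (Σ i, M i)) :
    letterProdLast F F l = letterProd F l := by
  induction l with
  | nil => simp [letterProdLast, letterProd]
  | cons a l ih =>
    cases l with
    | nil => simp [letterProdLast, letterProd]
    | cons b l => rw [letterProdLast, ih]; simp [letterProd]

variable [∀ i, Group (M i)]

/-- The total weight of the words of length `k` that do not start in the factor `i`. -/
def levelSum (γ : ∀ i, M i → ℝ≥0∞) (i : Bool) (k : ℕ) : ℝ≥0∞ :=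
  ∑' t : {t : Word M // t.fstIdx ≠ some i},
    if t.1.toList.length = k then letterProd γ t.1.toList else 0

/-- The total weight of the words of length `k`. -/
def sphereSum (γ : ∀ i, M i → ℝ≥0∞) (k : ℕ) : ℝ≥0∞ :=
  ∑' t : Word M, if t.toList.length = k then letterProd γ t.toList else 0

theorem levelSum_zero (γ : ∀ i, M i → ℝ≥0∞) (i : Bool) : levelSum γ i 0 = 1 := by
  rw [levelSum, tsum_eq_single ⟨Word.empty, by simp [Word.fstIdx]⟩]
  · simp [letterProd]
  · rintro ⟨t, ht⟩ h
    have : t.toList ≠ [] := fun h' => h (Subtype.ext (Word.ext h'))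
    simp [this]

theorem sphereSum_zero (γ : ∀ i, M i → ℝ≥0∞) : sphereSum γ 0 = 1 := by
  rw [sphereSum, tsum_eq_single Word.empty]
  · simp [letterProd]
  · rintro t h
    have : t.toList ≠ [] := fun h' => h (Word.ext h')
    simp [this]

theorem sum_range_sphereSum (γ : ∀ i, M i → ℝ≥0∞) (N : ℕ) :
    ∑ k ∈ Finset.range (N + 1), sphereSum γ k =
      ∑' w : Word M, if w.toList.length ≤ N then letterProd γ w.toList else 0 := by
  simp_rw [sphereSum]
  rw [← Summable.tsum_finsetSum fun _ _ => ENNReal.summable]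
  refine tsum_congr fun w => ?_
  rw [Finset.sum_ite_eq]
  simp

variable [∀ i, DecidableEq (M i)]

/-- If `t` is empty, a non-trivial `a` is the last letter and carries the weight `c`, not `F`; the
hypothesis `h` excludes a discrepancy between the two. -/
theorem letterProdLast_rcons {F c : ∀ i, M i → ℝ≥0∞} (hF : ∀ i, F i 1 = 1) {i : Bool} (a : M i)
    (t : Word M) (ht : t.fstIdx ≠ some i) (h : t ≠ Word.empty ∨ c i = F i) :
    letterProdLast F c (Word.rcons ⟨a, t, ht⟩).toList = F i a * letterProdLast F c t.toList := by
  by_cases ha : a = 1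
  · subst ha; simp [Word.rcons, hF]
  · simp only [Word.rcons, ha, dite_false, Word.cons_toList]
    rcases t with ⟨_ | ⟨b, l⟩, h1, h2⟩
    · rcases h with h | h
      · exact absurd rfl h
      · simp [letterProdLast, h]
    · rfl

theorem exists_eq_rcons (i : Bool) (w : Word M) :
    ∃ (b : M i) (t : Word M) (ht : t.fstIdx ≠ some i), w = Word.rcons ⟨b, t, ht⟩ :=
  ⟨_, _, (Word.equivPair i w).fstIdx_ne, ((Word.equivPair i).symm_apply_apply w).symm⟩

theorem of_smul_rcons {i : Bool} (a b : M i) (t : Word M) (ht : t.fstIdx ≠ some i) :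
    (of a : CoprodI M) • Word.rcons ⟨b, t, ht⟩ = Word.rcons ⟨a * b, t, ht⟩ := by
  rw [Word.rcons_eq_smul, Word.rcons_eq_smul, ← mul_smul, ← map_mul]

theorem length_of_smul_le {i : Bool} (a : M i) (w : Word M) :
    ((of a : CoprodI M) • w).toList.length ≤ w.toList.length + 1 := by
  obtain ⟨b, t, ht, rfl⟩ := exists_eq_rcons i w
  rw [of_smul_rcons]
  have h1 : (Word.rcons ⟨a * b, t, ht⟩).toList.length ≤ t.toList.length + 1 := by
    simp only [Word.rcons]
    split_ifs <;> simp
  have h2 : t.toList.length ≤ (Word.rcons ⟨b, t, ht⟩).toList.length := by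
    simp only [Word.rcons]
    split_ifs <;> simp
  omega

/-- Reduced words are pairs of a possibly trivial first letter from the factor `i` and a reduced
word whose first letter is not from this factor. -/
def wordEquivProd (i : Bool) : M i × {t : Word M // t.fstIdx ≠ some i} ≃ Word M where
  toFun p := Word.rcons ⟨p.1, p.2.1, p.2.2⟩
  invFun w := ((Word.equivPair i w).head,
    ⟨(Word.equivPair i w).tail, (Word.equivPair i w).fstIdx_ne⟩)
  left_inv p := by
    have h := (Word.equivPair i).apply_symm_apply ⟨p.1, p.2.1, p.2.2⟩
    rw [Word.equivPair_symm] at h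
    simp only [h]
  right_inv w := (Word.equivPair i).symm_apply_apply w

theorem tsum_word_start (γ : ∀ i, M i → ℝ≥0∞) (j : Bool) (k : ℕ) :
    ∑' w : Word M, (if w.toList.length = k + 1 ∧ w.fstIdx = some j then letterProd γ w.toList
      else 0) = (∑' a : M j, if a = 1 then 0 else γ j a) * levelSum γ j k := by
  rw [← (wordEquivProd j).tsum_eq, ENNReal.tsum_prod', ← ENNReal.tsum_mul_right]
  refine tsum_congr fun a => ?_
  rw [levelSum, ← ENNReal.tsum_mul_left]
  refine tsum_congr fun t => ?_
  by_cases ha : a = 1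
  · have h := t.2
    simp only [wordEquivProd, Equiv.coe_fn_mk, Word.rcons, ha, dite_true, if_true, zero_mul]
    rw [if_neg]
    exact fun h' => h h'.2
  · simp [wordEquivProd, Word.rcons, ha, letterProd]

/-- With only two factors, a non-empty word not starting in `i` starts in `!i`, and its tail does
not start there. -/
theorem levelSum_succ (γ : ∀ i, M i → ℝ≥0∞) (i : Bool) (k : ℕ) :
    levelSum γ i (k + 1) =
      (∑' a : M (!i), if a = 1 then 0 else γ (!i) a) * levelSum γ (!i) k := by
  rw [← tsum_word_start]
  refine (tsum_subtype {t : Word M | t.fstIdx ≠ some i}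
    (fun t => if t.toList.length = k + 1 then letterProd γ t.toList else 0)).trans ?_
  refine tsum_congr fun w => ?_
  induction w using Word.consRecOn with
  | empty => simp
  | cons j m w h1 h2 _ => cases i <;> cases j <;> simp

theorem sphereSum_succ (γ : ∀ i, M i → ℝ≥0∞) (k : ℕ) :
    sphereSum γ (k + 1) = levelSum γ true (k + 1) + levelSum γ false (k + 1) := by
  rw [levelSum_succ, levelSum_succ, ← tsum_word_start, ← tsum_word_start, ← ENNReal.tsum_add,
    sphereSum]
  refine tsum_congr fun w => ?_
  induction w using Word.consRecOn with
  | empty => simp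
  | cons j m w h1 h2 _ => cases j <;> simp

theorem levelSum_ne_top {γ : ∀ i, M i → ℝ≥0∞}
    (hγ : ∀ i, ∑' a : M i, (if a = 1 then 0 else γ i a) ≠ ∞) (i : Bool) (k : ℕ) :
    levelSum γ i k ≠ ∞ := by
  induction k generalizing i with
  | zero => simp [levelSum_zero]
  | succ k ih => rw [levelSum_succ]; exact ENNReal.mul_ne_top (hγ _) (ih _)

theorem sphereSum_ne_top {γ : ∀ i, M i → ℝ≥0∞}
    (hγ : ∀ i, ∑' a : M i, (if a = 1 then 0 else γ i a) ≠ ∞) (k : ℕ) : sphereSum γ k ≠ ∞ := by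
  cases k with
  | zero => simp [sphereSum_zero]
  | succ k =>
    rw [sphereSum_succ]
    exact ENNReal.add_ne_top.2 ⟨levelSum_ne_top hγ _ _, levelSum_ne_top hγ _ _⟩

theorem levelSum_two_mul {γ : ∀ i, M i → ℝ≥0∞}
    (hγ : (∑' a : M true, if a = 1 then 0 else γ true a) *
      (∑' a : M false, if a = 1 then 0 else γ false a) = 1) (i : Bool) (k : ℕ) :
    levelSum γ i (2 * k) = 1 := by
  induction k with
  | zero => exact levelSum_zero γ i
  | succ k ih =>
    rw [Nat.mul_succ, levelSum_succ, levelSum_succ, ← mul_assoc, Bool.not_not, ih, mul_one]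
    cases i
    · exact hγ
    · rw [mul_comm]; exact hγ

end Words

/-- `F` is a weight on the group `A`, normalised at the identity and `z⁻¹`-harmonic elsewhere for
the random walk with the step weights `m`; `U` is its defect at the identity. -/
structure IsHarmonicWeight {A : Type*} [Group A] (m F : A → ℝ≥0∞) (z U : ℝ≥0∞) : Prop where
  tsum_eq_one : ∑' y, m y = 1
  symm : ∀ y, m y⁻¹ = m y
  one : F 1 = 1
  harmonic : ∀ a, a ≠ 1 → z * ∑' y, m y * F (y * a) = F a
  defect : z * ∑' y, m y * F y = U
  tsum_ne_top : ∑' y, F y ≠ ∞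

/-! ### The harmonic product weight on the free product -/

section Core

open Monoid CoprodI

variable {M : Bool → Type*} [∀ i, Group (M i)] [∀ i, DecidableEq (M i)]
  {m F : ∀ i, M i → ℝ≥0∞} {z U : Bool → ℝ≥0∞}

/-- A step in factor `i` only alters the initial letter `b` from that factor. Harmonicity applies if
the letter is present; if it is absent (`b = 1`) the defect `U i` appears. -/
theorem step_letterProdLast (h : ∀ i, IsHarmonicWeight (m i) (F i) (z i) (U i))
    {c : ∀ i, M i → ℝ≥0∞} {i : Bool} (b : M i) (t : Word M) (ht : t.fstIdx ≠ some i)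
    (hc : t ≠ Word.empty ∨ c i = F i) :
    z i * ∑' a : M i, m i a *
        letterProdLast F c ((of a : CoprodI M) • Word.rcons ⟨b, t, ht⟩).toList =
      (if b = 1 then U i else 1) * letterProdLast F c (Word.rcons ⟨b, t, ht⟩).toList := by
  simp_rw [of_smul_rcons, letterProdLast_rcons (fun i => (h i).one) _ t ht hc, ← mul_assoc]
  rw [ENNReal.tsum_mul_right, ← mul_assoc]
  congr 1
  split_ifs with hb
  · simp [hb, (h i).defect, (h i).one]
  · rw [(h i).harmonic b hb, one_mul]

variable {c α : Bool → ℝ≥0∞} {r₀ : ℝ≥0∞}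

theorem sum_bool_eq (f : Bool → ℝ≥0∞) (i : Bool) : ∑ j, f j = f i + f (!i) := by
  cases i <;> simp [add_comm]

/-- At a word starting in `j`, steps in `j` contribute the factor `c j` and steps in the other
factor contribute `c (!j) * U (!j)`; by `hc` these add up to `1`. -/
theorem walk_step_eq_self (h : ∀ i, IsHarmonicWeight (m i) (F i) (z i) (U i))
    (hα : ∀ i, r₀ * α i = c i * z i) (hc : ∀ i, c i + c (!i) * U (!i) = 1)
    {d : ∀ i, M i → ℝ≥0∞} (w : Word M) (hw : w ≠ Word.empty)
    (hd : ∀ i b t ht, w = Word.rcons (i := i) ⟨b, t, ht⟩ → t ≠ Word.empty ∨ d i = F i) :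
    r₀ * ∑ i, α i * ∑' a : M i, m i a * letterProdLast F d ((of a : CoprodI M) • w).toList =
      letterProdLast F d w.toList := by
  obtain ⟨j, b, t, ht, hb, hwe⟩ : ∃ (j : Bool) (b : M j) (t : Word M) (ht : t.fstIdx ≠ some j),
      b ≠ 1 ∧ w = Word.rcons ⟨b, t, ht⟩ := by
    induction w using Word.consRecOn with
    | empty => exact absurd rfl hw
    | cons j b t h1 h2 _ => exact ⟨j, b, t, h1, h2, by simp [Word.rcons, h2]⟩
  have hn : w.fstIdx ≠ some (!j) := by
    rw [hwe]; simp [Word.rcons, hb]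
  have hwe' : w = Word.rcons ⟨1, w, hn⟩ := by simp [Word.rcons]
  have h1 := step_letterProdLast h b t ht (hd _ _ _ _ hwe)
  have h2 := step_letterProdLast h 1 w hn (hd _ _ _ _ hwe')
  rw [← hwe, if_neg hb, one_mul] at h1
  rw [← hwe', if_pos rfl] at h2
  rw [sum_bool_eq _ j, mul_add, ← mul_assoc, ← mul_assoc, hα, hα, mul_assoc, mul_assoc, h1, h2,
    ← mul_assoc, ← add_mul, hc, one_mul]

/-- On the factor `i` itself, a step in `i` stays where the weight is `1`, so it contributes only
its total mass `c i * z i` instead of `c i`. This is the gap behind non-degeneracy. -/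
theorem walk_step_singleton (h : ∀ i, IsHarmonicWeight (m i) (F i) (z i) (U i))
    (hα : ∀ i, r₀ * α i = c i * z i) {d : ∀ i, M i → ℝ≥0∞} {i : Bool} (hdi : d i = 1)
    (hd : d (!i) = F (!i)) (b : M i) :
    r₀ * ∑ j, α j * ∑' a : M j, m j a *
        letterProdLast F d ((of a : CoprodI M) • (of b : CoprodI M) • Word.empty).toList =
      c i * z i + c (!i) * U (!i) := by
  have he : (Word.empty : Word M).fstIdx ≠ some i := by simp [Word.fstIdx]
  have h0 : ∀ b : M i, letterProdLast F d (Word.rcons ⟨b, Word.empty, he⟩).toList = 1 := fun b => by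
    by_cases hb : b = 1 <;> simp [Word.rcons, hb, letterProdLast, hdi]
  have hw : (of b : CoprodI M) • Word.empty = Word.rcons ⟨b, Word.empty, he⟩ :=
    (Word.rcons_eq_smul ⟨b, Word.empty, he⟩).symm
  have hn : ((of b : CoprodI M) • (Word.empty : Word M)).fstIdx ≠ some (!i) := by
    rw [hw]
    by_cases hb : b = 1 <;> simp [Word.rcons, hb, Word.fstIdx]
  have hwe' : (of b : CoprodI M) • (Word.empty : Word M) = Word.rcons ⟨1, _, hn⟩ := by
    simp [Word.rcons]
  have h2 := step_letterProdLast (c := d) h 1 _ hn (Or.inr hd)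
  rw [← hwe', if_pos rfl, hw, h0, mul_one] at h2
  rw [sum_bool_eq _ i, mul_add, ← mul_assoc, ← mul_assoc, hα, hα, mul_assoc, mul_assoc, hw, h2]
  simp_rw [of_smul_rcons, h0, mul_one, (h i).tsum_eq_one, mul_one]

variable {G : Type*} [Group G] (e : G ≃* CoprodI M)

/-- The reduced word of the inverse of an element of the free product. -/
def invWord : G ≃ Word M := (Equiv.inv G).trans (e.toEquiv.trans Word.equiv)

theorem invWord_apply (x : G) : invWord e x = e x⁻¹ • (Word.empty : Word M) := rfl

theorem invWord_mul (x y : G) : invWord e (x * y) = e y⁻¹ • invWord e x := by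
  rw [invWord_apply, invWord_apply, mul_inv_rev, map_mul, mul_smul]

variable {μ : PMF G}

/-- The walk multiplies on the right, whereas reduced words are read and acted on from the left.
Passing to inverses reconciles the two, and symmetry of `m i` absorbs the inversion of the step. -/
theorem tsum_walk_invWord (h : ∀ i, IsHarmonicWeight (m i) (F i) (z i) (U i))
    (hμ : ∀ (f : G → ℝ≥0∞) (x : G), ∑' g, μ g * f (x * g) =
      ∑ i, α i * ∑' a : M i, m i a * f (x * e.symm (of a)))
    (f : Word M → ℝ≥0∞) (x : G) :
    ∑' g, μ g * f (invWord e (x * g)) =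
      ∑ i, α i * ∑' a : M i, m i a * f ((of a : CoprodI M) • invWord e x) := by
  rw [hμ (fun x => f (invWord e x))]
  refine Finset.sum_congr rfl fun i _ => ?_
  rw [← (Equiv.inv (M i)).tsum_eq]
  congr 1
  refine tsum_congr fun a => ?_
  rw [invWord_mul, Equiv.inv_apply, (h i).symm]
  simp

theorem not_degenerate_factor (h : ∀ i, IsHarmonicWeight (m i) (F i) (z i) (U i))
    (hμ : ∀ (f : G → ℝ≥0∞) (x : G), ∑' g, μ g * f (x * g) =
      ∑ i, α i * ∑' a : M i, m i a * f (x * e.symm (of a)))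
    (hα : ∀ i, r₀ * α i = c i * z i) (hc : ∀ i, c i + c (!i) * U (!i) = 1)
    (hlt : ∀ i, c i * z i < c i) (hR : walkR μ ≤ r₀) (i : Bool) (H : Subgroup G)
    (hH : ∀ x, x ∈ H ↔ ∃ a : M i, x = e.symm (of a)) : ¬ IsSpectrallyDegenerateAlong μ H := by
  -- The last letter of the word of `x⁻¹` is the inverse of the first letter of `x`. Giving it
  -- weight `1` in the factor `i` makes the function invariant under left multiplication by `H`.
  set d : ∀ j, M j → ℝ≥0∞ := Function.update F i 1 with hd
  have hdi : d i = 1 := by simp [hd]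
  have hdn : d (!i) = F (!i) := by simp [hd]
  have hH' : ∀ x, x ∈ H ↔ ∃ a : M i, invWord e x = (of a : CoprodI M) • Word.empty := fun x => by
    rw [← inv_mem_iff, hH]
    refine exists_congr fun a => ?_
    rw [invWord_apply, MulEquiv.eq_symm_apply]
    exact Word.equiv.injective.eq_iff.symm
  have hci := hc i
  have hfin : c (!i) * U (!i) ≠ ∞ := ne_top_of_le_ne_top ENNReal.one_ne_top
    (hci ▸ le_add_self)
  refine not_isSpectrallyDegenerateAlong (m := c i * z i + c (!i) * U (!i)) hR
    (hci ▸ (ENNReal.add_lt_add_iff_right hfin).2 (hlt i))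
    (fun x => letterProdLast F d (invWord e x).toList) ?_ ?_ ?_
  · intro x hx
    obtain ⟨a, ha⟩ := (hH' x).1 hx
    have he : (Word.empty : Word M).fstIdx ≠ some i := by simp [Word.fstIdx]
    rw [ha, ← Word.rcons_eq_smul ⟨a, Word.empty, he⟩]
    by_cases hb : a = 1 <;> simp [Word.rcons, hb, letterProdLast, hdi]
  · intro x hx
    rw [tsum_walk_invWord e h hμ (fun w => letterProdLast F d w.toList)]
    refine (walk_step_eq_self h hα hc _ ?_ ?_).le
    · intro hw
      exact hx ((hH' x).2 ⟨1, by simp [hw]⟩)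
    · intro j b t ht hw
      rcases Bool.eq_or_eq_not j i with rfl | rfl
      · left
        -- An empty tail would put `x` in `H`.
        rintro rfl
        exact hx ((hH' x).2 ⟨b, by rw [hw, Word.rcons_eq_smul]⟩)
      · exact Or.inr hdn
  · intro x hx
    obtain ⟨a, ha⟩ := (hH' x).1 hx
    rw [tsum_walk_invWord e h hμ (fun w => letterProdLast F d w.toList), ha]
    exact (walk_step_singleton h hα hdi hdn a).le

/-- The restriction of `∏ F` to the words of length at most `N`. -/
def ballWeight (F : ∀ i, M i → ℝ≥0∞) (N : ℕ) (w : Word M) : ℝ≥0∞ :=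
  if w.toList.length ≤ N then letterProd F w.toList else 0

/-- For lengths strictly between `0` and `N` all neighbours lie in the ball, so truncation does not
disturb harmonicity. Only the identity and the outer sphere need an error term. -/
theorem ballWeight_sq_le (h : ∀ i, IsHarmonicWeight (m i) (F i) (z i) (U i))
    (hα : ∀ i, r₀ * α i = c i * z i) (hc : ∀ i, c i + c (!i) * U (!i) = 1) (N : ℕ) (w : Word M) :
    ballWeight F N w ^ 2 ≤ r₀ * (ballWeight F N w * ∑ i, α i * ∑' a : M i, m i a *
      ballWeight F N ((of a : CoprodI M) • w)) +
      ((if w.toList.length = 0 then letterProd (fun i a => F i a ^ 2) w.toList else 0) +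
      (if w.toList.length = N then letterProd (fun i a => F i a ^ 2) w.toList else 0)) := by
  simp only [letterProd_sq]
  rcases lt_trichotomy w.toList.length N with hN | hN | hN
  · rcases eq_or_ne w.toList.length 0 with h0 | h0
    · simp only [ballWeight, h0, if_true]
      exact le_self_add.trans le_add_self
    · refine le_trans (le_of_eq ?_) le_self_add
      have hw : w ≠ Word.empty := by rintro rfl; simp at h0
      have hs := walk_step_eq_self h hα hc (d := F) w hw fun _ _ _ _ _ => Or.inr rfl
      simp_rw [letterProdLast_self] at hs
      have hb : ∀ i (a : M i), ballWeight F N ((of a : CoprodI M) • w) =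
          letterProd F ((of a : CoprodI M) • w).toList := fun i a => by
        rw [ballWeight, if_pos]
        have := length_of_smul_le a w
        omega
      simp_rw [hb]
      rw [mul_left_comm, hs, ballWeight, if_pos hN.le, sq]
  · simp only [ballWeight, hN, le_refl, if_true]
    exact le_add_self.trans le_add_self
  · simp [ballWeight, hN.not_ge]

theorem walkR_le_core (hsym : IsSymmetric μ)
    (h : ∀ i, IsHarmonicWeight (m i) (F i) (z i) (U i))
    (hμ : ∀ (f : G → ℝ≥0∞) (x : G), ∑' g, μ g * f (x * g) =
      ∑ i, α i * ∑' a : M i, m i a * f (x * e.symm (of a)))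
    (hα : ∀ i, r₀ * α i = c i * z i) (hc : ∀ i, c i + c (!i) * U (!i) = 1)
    (h0 : r₀ ≠ 0) (htop : r₀ ≠ ∞)
    (hA : (∑' a : M true, if a = 1 then 0 else F true a ^ 2) *
      (∑' a : M false, if a = 1 then 0 else F false a ^ 2) = 1) :
    walkR μ ≤ r₀ := by
  have hl := levelSum_two_mul (γ := fun i a => F i a ^ 2) hA
  have hs1 : ∀ k, sphereSum (fun i a => F i a ^ 2) (2 * (k + 1)) = 2 := fun k => by
    have h1 := hl true (k + 1)
    have h2 := hl false (k + 1)
    rw [mul_add, mul_one] at h1 h2 ⊢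
    rw [sphereSum_succ]
    exact (congrArg₂ (· + ·) h1 h2).trans one_add_one_eq_two
  have hs2 : ∀ k, sphereSum (fun i a => F i a ^ 2) (2 * k) ≤ 2 := fun k => by
    cases k with
    | zero => rw [mul_zero, sphereSum_zero]; exact one_le_two
    | succ k => exact (hs1 k).le
  have hsq : ∀ N, ∑' x, ballWeight F N (invWord e x) ^ 2 =
      ∑ k ∈ Finset.range (N + 1), sphereSum (fun i a => F i a ^ 2) k := fun N => by
    rw [(invWord e).tsum_eq (fun w => ballWeight F N w ^ 2), sum_range_sphereSum]
    refine tsum_congr fun w => ?_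
    rw [letterProd_sq, ballWeight]
    split_ifs <;> simp
  refine walkR_le_of_quadForm hsym h0 htop (fun N x => ballWeight F (2 * N) (invWord e x)) ?_
    -- `1` is the error at the identity, and `2` bounds the mass of the outer sphere, uniformly
    -- because only even radii `2 * N` are used.
    (C := 1 + 2) (by finiteness) ?_ ?_
  · intro N
    rw [(invWord e).tsum_eq (ballWeight F (2 * N))]
    have := sum_range_sphereSum F (2 * N)
    simp only [ballWeight]
    rw [← this]
    refine ENNReal.sum_ne_top.2 fun k _ => sphereSum_ne_top (fun i => ?_) k
    refine ne_top_of_le_ne_top (h i).tsum_ne_top (ENNReal.tsum_le_tsum fun a => ?_)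
    split_ifs
    · exact zero_le
    · exact le_rfl
  · intro N
    simp_rw [tsum_walk_invWord e h hμ (ballWeight F (2 * N))]
    rw [(invWord e).tsum_eq (fun w => ballWeight F (2 * N) w ^ 2),
      (invWord e).tsum_eq (fun w => ballWeight F (2 * N) w * ∑ i, α i * ∑' a : M i, m i a *
        ballWeight F (2 * N) ((of a : CoprodI M) • w))]
    refine (ENNReal.tsum_le_tsum (ballWeight_sq_le h hα hc (2 * N))).trans ?_
    rw [ENNReal.tsum_add, ENNReal.tsum_mul_left, ENNReal.tsum_add]
    have e0 := sphereSum_zero (fun i (a : M i) => F i a ^ 2)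
    have eN := hs2 N
    rw [sphereSum] at e0 eN
    rw [e0]
    gcongr
  · simp_rw [hsq]
    refine tendsto_nhds_top_mono ENNReal.tendsto_nat_nhds_top (Eventually.of_forall fun N => ?_)
    dsimp only
    induction N with
    | zero => simp
    | succ N ih =>
      rw [show 2 * (N + 1) + 1 = 2 * N + 1 + 1 + 1 by ring, Finset.sum_range_succ,
        show 2 * N + 1 + 1 = 2 * (N + 1) by ring, hs1, show 2 * (N + 1) = 2 * N + 1 + 1 by ring,
        Finset.sum_range_succ, Nat.cast_add, Nat.cast_one]
      exact add_le_add (ih.trans le_self_add) one_le_two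

end Core

/-! ### Green functions on one factor, and a maximum principle -/

section Green

variable {A : Type*} [Group A] (μ : PMF A)

/-- The Green function `∑ zⁿ Pⁿ(x, 1)` of the random walk driven by `μ`. -/
def green (z : ℝ≥0∞) (x : A) : ℝ≥0∞ := ∑' n : ℕ, z ^ n * kernelPow (walkKernel μ) n x 1

theorem green_eq (z : ℝ≥0∞) (x : A) :
    green μ z x = Set.indicator {x} (fun _ => 1) 1 + z * ∑' y, μ y * green μ z (x * y) := by
  rw [green, tsum_eq_zero_add' ENNReal.summable]
  congr 1
  · simp [kernelPow]
  · simp only [kernelPow, green, tsum_walkKernel_mul, ← ENNReal.tsum_mul_left]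
    rw [ENNReal.tsum_comm]
    exact tsum_congr fun y => tsum_congr fun n => by ring

theorem green_inv {μ : PMF A} (hμ : IsSymmetric μ) (z : ℝ≥0∞) (x : A) :
    green μ z x⁻¹ = green μ z x := by
  refine tsum_congr fun n => ?_
  rw [← kernelPow_walkKernel_mul_left μ n x x⁻¹ 1, mul_inv_cancel, mul_one,
    kernelPow_symm _ (walkKernel_symm hμ)]

theorem tsum_walkKernel (x : A) : ∑' y, walkKernel μ x y = 1 := by
  have := tsum_walkKernel_mul μ (fun _ => 1) x
  simpa [μ.tsum_coe] using this

theorem kernelPow_walkKernel_le_one (n : ℕ) (x y : A) : kernelPow (walkKernel μ) n x y ≤ 1 :=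
  (ENNReal.le_tsum y).trans
    ((tsum_kernelPow_le _ (fun x => (tsum_walkKernel μ x).le) n x).trans (one_pow n).le)

theorem tsum_green_ne_top {μ : PMF A} (hμ : IsSymmetric μ) {z : ℝ≥0∞} (hz : z < 1) :
    ∑' x, green μ z x ≠ ∞ := by
  have h : ∑' x, green μ z x ≤ ∑' n : ℕ, z ^ n := by
    simp only [green]
    rw [ENNReal.tsum_comm]
    refine ENNReal.tsum_le_tsum fun n => ?_
    rw [ENNReal.tsum_mul_left]
    simp_rw [fun x => kernelPow_symm _ (walkKernel_symm hμ) n x 1]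
    refine (mul_le_mul_right (tsum_kernelPow_le _ (fun x => (tsum_walkKernel μ x).le) n 1) _).trans
      ?_
    simp
  rw [ENNReal.tsum_geometric] at h
  exact ne_top_of_le_ne_top (by simpa using (tsub_pos_of_lt hz).ne') h

theorem green_ne_top {μ : PMF A} (hμ : IsSymmetric μ) {z : ℝ≥0∞} (hz : z < 1) (x : A) :
    green μ z x ≠ ∞ :=
  ne_top_of_le_ne_top (tsum_green_ne_top hμ hz) (ENNReal.le_tsum x)

theorem green_one_ne_zero (z : ℝ≥0∞) : green μ z 1 ≠ 0 := by
  rw [green_eq]; simp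

/-- The Green function normalised at the identity. -/
def hitting (z : ℝ≥0∞) (x : A) : ℝ≥0∞ := green μ z x / green μ z 1

/-- The return probability generating function at the identity. -/
def returnGen (z : ℝ≥0∞) : ℝ≥0∞ := z * ∑' y, μ y * hitting μ z y

variable {μ} (hμ : IsSymmetric μ) {z : ℝ≥0∞} (hz : z < 1)
include hμ hz

theorem hitting_one : hitting μ z 1 = 1 :=
  ENNReal.div_self (green_one_ne_zero μ z) (green_ne_top hμ hz 1)

omit hz in
theorem hitting_inv (x : A) : hitting μ z x⁻¹ = hitting μ z x := by
  rw [hitting, green_inv hμ, hitting]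

omit hμ hz in
theorem tsum_mul_hitting (x : A) :
    z * ∑' y, μ y * hitting μ z (x * y) =
      (z * ∑' y, μ y * green μ z (x * y)) / green μ z 1 := by
  simp only [hitting, div_eq_mul_inv, ← mul_assoc]
  rw [ENNReal.tsum_mul_right, mul_assoc]

omit hμ hz in
theorem hitting_harmonic {x : A} (hx : x ≠ 1) :
    z * ∑' y, μ y * hitting μ z (x * y) = hitting μ z x := by
  rw [tsum_mul_hitting, hitting, green_eq μ z x]
  simp [Ne.symm hx]

/-- The renewal identity `G = 1 + U G` at the identity, divided by `G`. -/
theorem returnGen_add : returnGen μ z + (green μ z 1)⁻¹ = 1 := by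
  have h := tsum_mul_hitting (μ := μ) (z := z) 1
  simp only [one_mul] at h
  rw [returnGen, h, ← one_div, ← ENNReal.add_div, add_comm]
  have h1 := green_eq μ z 1
  simp only [one_mul, Set.mem_singleton_iff, Set.indicator_of_mem] at h1
  rw [← h1]
  exact hitting_one hμ hz

theorem returnGen_lt_one : returnGen μ z < 1 := by
  have h := returnGen_add hμ hz
  have hne : returnGen μ z ≠ ∞ := ne_top_of_le_ne_top ENNReal.one_ne_top (h ▸ le_self_add)
  calc returnGen μ z < returnGen μ z + (green μ z 1)⁻¹ :=
        ENNReal.lt_add_right hne (ENNReal.inv_ne_zero.2 (green_ne_top hμ hz 1))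
    _ = 1 := h

theorem isHarmonicWeight_hitting : IsHarmonicWeight μ (hitting μ z) z (returnGen μ z) where
  tsum_eq_one := μ.tsum_coe
  symm := hμ
  one := hitting_one hμ hz
  harmonic a ha := by
    rw [← hitting_inv hμ a, ← hitting_harmonic (inv_ne_one.2 ha),
      ← (Equiv.inv A).tsum_eq fun y => μ y * hitting μ z (a⁻¹ * y)]
    congr 1
    refine tsum_congr fun y => ?_
    rw [Equiv.inv_apply, hμ, ← hitting_inv hμ (y * a), mul_inv_rev]
  defect := rfl
  tsum_ne_top := by
    simp only [hitting, div_eq_mul_inv]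
    rw [ENNReal.tsum_mul_right]
    exact ENNReal.mul_ne_top (tsum_green_ne_top hμ hz)
      (ENNReal.inv_ne_top.2 (green_one_ne_zero μ z))

-- Maximum principle off `B`. Since `z < 1`, each use of the two inequalities shrinks the possible
-- excess of `v` over `f` by the factor `z`, starting from the bound `C`.
omit hμ in
theorem le_of_subharmonic {f v : A → ℝ≥0∞} {C : ℝ≥0∞} (hC : C ≠ ∞) (hv : ∀ x, v x ≤ C)
    (B : Set A) (hB : ∀ x ∈ B, v x ≤ f x) (hf : ∀ x ∉ B, z * ∑' y, μ y * f (x * y) ≤ f x)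
    (hsub : ∀ x ∉ B, v x ≤ z * ∑' y, μ y * v (x * y)) (x : A) : v x ≤ f x := by
  have h : ∀ (n : ℕ) (x : A), v x ≤ f x + C * z ^ n := by
    intro n
    induction n with
    | zero => intro x; simpa using (hv x).trans le_add_self
    | succ n ih =>
      intro x
      by_cases hx : x ∈ B
      · exact (hB x hx).trans le_self_add
      · calc v x ≤ z * ∑' y, μ y * (f (x * y) + C * z ^ n) := by
              refine (hsub x hx).trans ?_
              gcongr
              exact ih _
          _ = z * ∑' y, μ y * f (x * y) + C * z ^ (n + 1) := by
              simp_rw [mul_add]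
              rw [ENNReal.tsum_add, ENNReal.tsum_mul_right, μ.tsum_coe]
              ring
          _ ≤ _ := by gcongr; exact hf x hx
  have hlim : Tendsto (fun n : ℕ => f x + C * z ^ n) atTop (nhds (f x + C * 0)) :=
    tendsto_const_nhds.add (ENNReal.Tendsto.const_mul
      (ENNReal.tendsto_pow_atTop_nhds_zero_of_lt_one hz) (Or.inr hC))
  rw [mul_zero, add_zero] at hlim
  exact ge_of_tendsto' hlim fun n => h n x

theorem hitting_le_one (x : A) : hitting μ z x ≤ 1 := by
  refine le_of_subharmonic (μ := μ) hz (f := fun _ => 1) (v := hitting μ z)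
    -- Any finite a priori bound on `hitting` serves; this crude one comes from the summability of
    -- `green`.
    (C := 1 / green μ z 1 * ∑' x, green μ z x) ?_ (fun x => ?_) {1} ?_ ?_ ?_ x
  · exact ENNReal.mul_ne_top (ENNReal.div_ne_top ENNReal.one_ne_top (green_one_ne_zero μ z))
      (tsum_green_ne_top hμ hz)
  · rw [hitting, div_eq_mul_inv, mul_comm, one_div]
    exact mul_le_mul_right (ENNReal.le_tsum x) _
  · rintro x rfl; exact (hitting_one hμ hz).le
  · intro x _
    simp [μ.tsum_coe, hz.le]
  · intro x hx; exact (hitting_harmonic hx).ge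

/-- Going from `s * s` to `1` by way of `s` is one of the possible routes. Formally, `F(s) F(s⁻¹ x)`
is harmonic off `s` and is compared with `F(x)` off `{1, s}`. -/
theorem hitting_sq_le (s : A) : hitting μ z s ^ 2 ≤ hitting μ z (s * s) := by
  have h := le_of_subharmonic (μ := μ) hz (f := hitting μ z)
    (v := fun x => hitting μ z s * hitting μ z (s⁻¹ * x)) (C := 1) ENNReal.one_ne_top
    (fun x => mul_le_one' (hitting_le_one hμ hz _) (hitting_le_one hμ hz _)) {1, s} ?_ ?_ ?_ (s * s)
  · simpa [sq] using h
  · rintro x (rfl | rfl)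
    · rw [hitting_one hμ hz]
      exact mul_le_one' (hitting_le_one hμ hz _) (hitting_le_one hμ hz _)
    · simp [hitting_one hμ hz]
  · intro x hx
    exact (hitting_harmonic fun h => hx (Or.inl h)).le
  · intro x hx
    have hne : s⁻¹ * x ≠ 1 := fun h => hx (Or.inr (inv_mul_eq_one.1 h).symm)
    rw [← hitting_harmonic hne, mul_left_comm, ← ENNReal.tsum_mul_left]
    simp_rw [mul_assoc]
    refine le_of_eq ?_
    congr 1
    exact tsum_congr fun y => mul_left_comm _ _ _

end Green

/-! ### Continuity in `z` of the sum of squares -/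

section HittingSum

variable {A : Type*} [Group A] {μ : PMF A}

open Classical in
/-- The sum of the squares of the normalised Green function away from the identity. -/
def hittingSum (μ : PMF A) (z : ℝ≥0∞) : ℝ≥0∞ := ∑' x : A, if x = 1 then 0 else hitting μ z x ^ 2

/-- Expand the square and apply Chapman–Kolmogorov. The `ℓ²` norm becomes a power series in `z`
built from return probabilities alone, so its continuity is elementary. -/
theorem tsum_green_sq (hμ : IsSymmetric μ) (z : ℝ≥0∞) :
    ∑' x, green μ z x ^ 2 =
      ∑' p : ℕ × ℕ, z ^ (p.1 + p.2) * kernelPow (walkKernel μ) (p.1 + p.2) 1 1 := by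
  rw [ENNReal.tsum_prod (f := fun n m : ℕ => z ^ (n + m) * kernelPow (walkKernel μ) (n + m) 1 1)]
  calc ∑' x, green μ z x ^ 2
      = ∑' x, ∑' n, ∑' m, z ^ (n + m) *
        (kernelPow (walkKernel μ) n 1 x * kernelPow (walkKernel μ) m x 1) := by
        refine tsum_congr fun x => ?_
        rw [sq, green, ← ENNReal.tsum_mul_right]
        refine tsum_congr fun n => ?_
        rw [← ENNReal.tsum_mul_left]
        refine tsum_congr fun m => ?_
        rw [kernelPow_symm _ (walkKernel_symm hμ) n 1 x, pow_add]
        ring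
    _ = ∑' n, ∑' x, ∑' m, z ^ (n + m) *
        (kernelPow (walkKernel μ) n 1 x * kernelPow (walkKernel μ) m x 1) := ENNReal.tsum_comm
    _ = _ := by
        refine tsum_congr fun n => ?_
        rw [ENNReal.tsum_comm]
        refine tsum_congr fun m => ?_
        rw [ENNReal.tsum_mul_left, kernelPow_add]

theorem one_add_hittingSum (hμ : IsSymmetric μ) {z : ℝ≥0∞} (hz : z < 1) :
    (1 + hittingSum μ z) * green μ z 1 ^ 2 = ∑' x, green μ z x ^ 2 := by
  classical
  have h : 1 + hittingSum μ z = ∑' x, hitting μ z x ^ 2 := by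
    rw [ENNReal.tsum_eq_add_tsum_ite (f := fun x => hitting μ z x ^ 2) (1 : A),
      hitting_one hμ hz, one_pow, hittingSum]
  rw [h, ← ENNReal.tsum_mul_right]
  refine tsum_congr fun x => ?_
  rw [← mul_pow, hitting, ENNReal.div_mul_cancel (green_one_ne_zero μ z) (green_ne_top hμ hz 1)]

/-- Intermediate value theorem applied to `E - (1 + a) g²`, where `g` is the Green function at `1`
and `E` the sum of its squares. This difference has the sign of `hittingSum - a` and avoids dividing
by `g`. -/
theorem exists_hittingSum_eq (hμ : IsSymmetric μ) {z₀ a : ℝ≥0∞} (hz₀ : z₀ < 1) (ha0 : a ≠ 0)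
    (ha : a ≠ ∞) (hle : a ≤ hittingSum μ z₀) : ∃ z, z ≠ 0 ∧ z < 1 ∧ hittingSum μ z = a := by
  set q : ℕ → ℝ := fun n => (kernelPow (walkKernel μ) n 1 1).toReal with hq
  have hk : ∀ n, kernelPow (walkKernel μ) n 1 1 ≠ ∞ := fun n =>
    ne_top_of_le_ne_top ENNReal.one_ne_top (kernelPow_walkKernel_le_one μ n 1 1)
  have hq0 : ∀ n, 0 ≤ q n := fun n => ENNReal.toReal_nonneg
  have hq1 : ∀ n, q n ≤ 1 := fun n => by
    simpa using ENNReal.toReal_mono ENNReal.one_ne_top (kernelPow_walkKernel_le_one μ n 1 1)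
  have hqq : ∀ n, kernelPow (walkKernel μ) n 1 1 = ENNReal.ofReal (q n) := fun n =>
    (ENNReal.ofReal_toReal (hk n)).symm
  set r₀ := z₀.toReal with hr₀
  have hr0 : 0 ≤ r₀ := ENNReal.toReal_nonneg
  have hr1 : r₀ < 1 := by
    simpa using (ENNReal.toReal_lt_toReal (hz₀.ne_top) ENNReal.one_ne_top).2 hz₀
  have hz₀r : z₀ = ENNReal.ofReal r₀ := (ENNReal.ofReal_toReal hz₀.ne_top).symm
  set g : ℝ → ℝ := fun r => ∑' n : ℕ, r ^ n * q n with hg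
  set E : ℝ → ℝ := fun r => ∑' p : ℕ × ℕ, r ^ (p.1 + p.2) * q (p.1 + p.2) with hE
  have hsum1 : Summable fun n : ℕ => r₀ ^ n := summable_geometric_of_lt_one hr0 hr1
  have hsum2 : Summable fun p : ℕ × ℕ => r₀ ^ (p.1 + p.2) := by
    simp_rw [pow_add]
    exact hsum1.mul_of_nonneg hsum1 (fun n => by positivity) (fun n => by positivity)
  have hb : ∀ (n : ℕ) (r : ℝ), r ∈ Set.Icc 0 r₀ → ‖r ^ n * q n‖ ≤ r₀ ^ n := fun n r hr => by
    rw [Real.norm_of_nonneg (mul_nonneg (pow_nonneg hr.1 n) (hq0 n))]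
    calc r ^ n * q n ≤ r₀ ^ n * 1 :=
          mul_le_mul (pow_le_pow_left₀ hr.1 hr.2 n) (hq1 n) (hq0 n) (by positivity)
      _ = r₀ ^ n := mul_one _
  have hgc : ContinuousOn g (Set.Icc 0 r₀) :=
    continuousOn_tsum (fun n => by fun_prop) hsum1 fun n r hr => hb n r hr
  have hEc : ContinuousOn E (Set.Icc 0 r₀) :=
    continuousOn_tsum (fun n => by fun_prop) hsum2 fun n r hr => hb _ r hr
  have hg_eq : ∀ r ∈ Set.Icc 0 r₀, green μ (ENNReal.ofReal r) 1 = ENNReal.ofReal (g r) :=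
    fun r hr => by
      rw [hg, ENNReal.ofReal_tsum_of_nonneg (fun n => mul_nonneg (pow_nonneg hr.1 n) (hq0 n))
        (Summable.of_norm_bounded hsum1 fun n => hb n r hr)]
      refine tsum_congr fun n => ?_
      rw [ENNReal.ofReal_mul (pow_nonneg hr.1 n), ENNReal.ofReal_pow hr.1, hqq]
  have hE_eq : ∀ r ∈ Set.Icc 0 r₀, ∑' x, green μ (ENNReal.ofReal r) x ^ 2 =
      ENNReal.ofReal (E r) := fun r hr => by
    rw [tsum_green_sq hμ, hE,
      ENNReal.ofReal_tsum_of_nonneg (fun n => mul_nonneg (pow_nonneg hr.1 _) (hq0 _))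
        (Summable.of_norm_bounded hsum2 fun n => hb _ r hr)]
    refine tsum_congr fun n => ?_
    rw [ENNReal.ofReal_mul (pow_nonneg hr.1 _), ENNReal.ofReal_pow hr.1, hqq]
  have hg0 : ∀ r ∈ Set.Icc 0 r₀, 0 ≤ g r := fun r hr =>
    tsum_nonneg fun n => mul_nonneg (pow_nonneg hr.1 n) (hq0 n)
  have hE0 : ∀ r ∈ Set.Icc 0 r₀, 0 ≤ E r := fun r hr =>
    tsum_nonneg fun n => mul_nonneg (pow_nonneg hr.1 _) (hq0 _)
  have ha' : 0 < a.toReal := ENNReal.toReal_pos ha0 ha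
  have haa : 1 + a = ENNReal.ofReal (1 + a.toReal) := by
    rw [ENNReal.ofReal_add zero_le_one ha'.le, ENNReal.ofReal_one, ENNReal.ofReal_toReal ha]
  have hag : ∀ r ∈ Set.Icc 0 r₀, (1 + a) * green μ (ENNReal.ofReal r) 1 ^ 2 =
      ENNReal.ofReal ((1 + a.toReal) * g r ^ 2) := fun r hr => by
    rw [hg_eq r hr, haa, ENNReal.ofReal_mul (by positivity), ENNReal.ofReal_pow (hg0 r hr)]
  have hq00 : q 0 = 1 := by simp [hq, kernelPow]
  have h0 : (0 : ℝ) ∈ Set.Icc 0 r₀ := ⟨le_rfl, hr0⟩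
  have hr₀m : r₀ ∈ Set.Icc 0 r₀ := ⟨hr0, le_rfl⟩
  have hgz : g 0 = 1 := by
    rw [hg]; dsimp only
    rw [tsum_eq_single 0 (fun n hn => by simp [hn])]; simp [hq00]
  have hEz : E 0 = 1 := by
    rw [hE]; dsimp only
    rw [tsum_eq_single (0, 0)]
    · simp [hq00]
    · rintro ⟨n, m⟩ hnm
      have : n + m ≠ 0 := fun h => hnm (by
        rw [(Nat.add_eq_zero_iff.1 h).1, (Nat.add_eq_zero_iff.1 h).2])
      rw [zero_pow this, zero_mul]
  have hfc : ContinuousOn (fun r => E r - (1 + a.toReal) * g r ^ 2) (Set.Icc 0 r₀) := by fun_prop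
  have hright : 0 ≤ E r₀ - (1 + a.toReal) * g r₀ ^ 2 := by
    rw [sub_nonneg, ← ENNReal.ofReal_le_ofReal_iff (hE0 _ hr₀m), ← hag _ hr₀m, ← hE_eq _ hr₀m,
      ← hz₀r, ← one_add_hittingSum hμ hz₀]
    gcongr
  -- The value at `0` is `-a`; strictness also yields `z ≠ 0`.
  have hleft : E 0 - (1 + a.toReal) * g 0 ^ 2 < 0 := by rw [hgz, hEz]; linarith
  obtain ⟨r, hr, hr'⟩ := intermediate_value_Icc hr0 hfc ⟨hleft.le, hright⟩
  have hrne : r ≠ 0 := by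
    rintro rfl
    exact hleft.ne hr'
  have hrlt : ENNReal.ofReal r < 1 := by
    rw [ENNReal.ofReal_lt_one]; exact hr.2.trans_lt hr1
  refine ⟨ENNReal.ofReal r, ?_, hrlt, ?_⟩
  · simpa using lt_of_le_of_ne hr.1 hrne.symm
  · have h1 := one_add_hittingSum hμ hrlt
    rw [hE_eq r hr, sub_eq_zero.1 hr', ← hag r hr] at h1
    have h2 := (ENNReal.mul_left_inj (pow_ne_zero 2 (green_one_ne_zero μ _))
      (ENNReal.pow_ne_top (green_ne_top hμ hrlt 1))).1 h1
    exact (ENNReal.add_right_inj ENNReal.one_ne_top).1 h2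

end HittingSum

/-! ### Symmetric admissible measures concentrated on two elements -/

section Mixture

variable {X : Type*}

/-- The convex combination `a p + b q` of two probability mass functions. -/
def pmfMix (a b : ℝ≥0∞) (hab : a + b = 1) (p q : PMF X) : PMF X :=
  ⟨fun x => a * p x + b * q x, ENNReal.summable.hasSum_iff.2 (by
    rw [ENNReal.tsum_add, ENNReal.tsum_mul_left, ENNReal.tsum_mul_left, p.tsum_coe, q.tsum_coe,
      mul_one, mul_one, hab])⟩

theorem pmfMix_apply {a b : ℝ≥0∞} (hab : a + b = 1) (p q : PMF X) (x : X) :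
    pmfMix a b hab p q x = a * p x + b * q x := rfl

theorem tsum_pmfMix_mul {a b : ℝ≥0∞} (hab : a + b = 1) (p q : PMF X) (k : X → ℝ≥0∞) :
    ∑' x, pmfMix a b hab p q x * k x = a * ∑' x, p x * k x + b * ∑' x, q x * k x := by
  simp_rw [pmfMix_apply, add_mul, mul_assoc]
  rw [ENNReal.tsum_add, ENNReal.tsum_mul_left, ENNReal.tsum_mul_left]

theorem support_pmfMix {a b : ℝ≥0∞} (hab : a + b = 1) (ha : a ≠ 0) (hb : b ≠ 0) (p q : PMF X) :
    (pmfMix a b hab p q).support = p.support ∪ q.support := by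
  ext x
  simp [PMF.mem_support_iff, pmfMix_apply, ha, hb]
  tauto

theorem tsum_pure_mul (s : X) (k : X → ℝ≥0∞) : ∑' x, PMF.pure s x * k x = k s := by
  rw [tsum_eq_single s fun x hx => by simp [PMF.pure_apply, hx]]
  simp

variable {A : Type*} [Group A]

theorem exists_symmetric_admissible [Group.FG A] :
    ∃ κ : PMF A, IsFinitelySupported κ ∧ IsSymmetric κ ∧ IsAdmissible κ := by
  classical
  obtain ⟨S, hS⟩ := Group.fg_def.1 (inferInstance : Group.FG A)
  -- The identity is included so that the semigroup, not just the monoid, generated by `T` is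
  -- everything.
  set T : Finset A := insert 1 (S ∪ S.image fun x => x⁻¹) with hT
  have hne : T.Nonempty := ⟨1, by simp [hT]⟩
  have hinv : ∀ x, x⁻¹ ∈ T ↔ x ∈ T := fun x => by
    simp only [hT, Finset.mem_insert, Finset.mem_union, Finset.mem_image, inv_eq_one,
      inv_inj, exists_eq_right]
    constructor
    · rintro (h | h | h)
      · exact Or.inl h
      · exact Or.inr (Or.inr ⟨_, h, inv_inv x⟩)
      · exact Or.inr (Or.inl h)
    · rintro (h | h | ⟨y, h, rfl⟩)
      · exact Or.inl h
      · exact Or.inr (Or.inr h)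
      · exact Or.inr (Or.inl (by simpa using h))
  refine ⟨PMF.uniformOfFinset T hne, ?_, ?_, ?_⟩
  · rw [IsFinitelySupported, PMF.support_uniformOfFinset]; exact T.finite_toSet
  · intro x
    simp only [PMF.uniformOfFinset_apply, hinv]
  · rw [IsAdmissible, PMF.support_uniformOfFinset, eq_top_iff]
    rintro x -
    have hx : x ∈ Submonoid.closure (S ∪ (S : Set A)⁻¹ : Set A) := by
      rw [← Subgroup.closure_toSubmonoid, hS]; trivial
    have hmem : ∀ y ∈ T, y ∈ Subsemigroup.closure (T : Set A) := fun y hy =>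
      Subsemigroup.subset_closure hy
    induction hx using Submonoid.closure_induction with
    | mem y hy =>
      refine hmem y ?_
      rcases hy with hy | hy
      · simp only [hT, Finset.mem_insert, Finset.mem_union]; exact Or.inr (Or.inl hy)
      · rw [← hinv]
        simp only [hT, Finset.mem_insert, Finset.mem_union]; exact Or.inr (Or.inl hy)
    | one => exact hmem 1 (by simp [hT])
    | mul y w _ _ hy hw => exact mul_mem hy hw

/-- Mass `u` is split evenly between `s` and `t`; the remaining mass `v` on a generating set secures
admissibility. -/
theorem exists_concentrated [Group.FG A] {u v : ℝ≥0∞} (huv : u + v = 1) (hu : u ≠ 0) (hv : v ≠ 0)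
    {s t : A} (hst : s⁻¹ = t ∨ s⁻¹ = s ∧ t⁻¹ = t) :
    ∃ μ : PMF A, IsFinitelySupported μ ∧ IsSymmetric μ ∧ IsAdmissible μ ∧
      ∀ k : A → ℝ≥0∞, u * (2⁻¹ * (k s + k t)) ≤ ∑' y, μ y * k y := by
  obtain ⟨κ, hκ1, hκ2, hκ3⟩ := exists_symmetric_admissible (A := A)
  set ν : PMF A := pmfMix 2⁻¹ 2⁻¹ ENNReal.inv_two_add_inv_two (PMF.pure s) (PMF.pure t) with hν
  have hνs : IsSymmetric ν := fun x => by
    have e : ∀ y : A, PMF.pure y x⁻¹ = PMF.pure y⁻¹ x := fun y => by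
      by_cases h : x = y⁻¹
      · simp [h]
      · have h' : x⁻¹ ≠ y := fun h' => h (inv_eq_iff_eq_inv.1 h')
        rw [PMF.pure_apply_of_ne _ _ h, PMF.pure_apply_of_ne _ _ h']
    rw [hν, pmfMix_apply, pmfMix_apply, e, e]
    rcases hst with rfl | ⟨h1, h2⟩
    · rw [inv_inv, add_comm]
    · rw [h1, h2]
  have h2 : (2⁻¹ : ℝ≥0∞) ≠ 0 := by simp
  refine ⟨pmfMix u v huv ν κ, ?_, ?_, ?_, ?_⟩
  · rw [IsFinitelySupported, support_pmfMix huv hu hv, hν, support_pmfMix _ h2 h2]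
    refine Set.Finite.union ?_ hκ1
    simp
  · intro x
    change u * ν x⁻¹ + v * κ x⁻¹ = u * ν x + v * κ x
    rw [hνs, hκ2]
  · rw [IsAdmissible, support_pmfMix huv hu hv, eq_top_iff, ← hκ3]
    exact Subsemigroup.closure_mono Set.subset_union_right
  · intro k
    rw [tsum_pmfMix_mul, hν, tsum_pmfMix_mul, tsum_pure_mul, tsum_pure_mul, ← mul_add]
    exact le_self_add

end Mixture

/-! ### Lower bounds for the sum of squares -/

section Bounds

variable {A : Type*} [Group A] {μ : PMF A}

theorem hitting_ge_of_step (hμ : IsSymmetric μ) {z : ℝ≥0∞} (hz : z < 1) {u : ℝ≥0∞} {s t : A}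
    (h : ∀ k : A → ℝ≥0∞, u * (2⁻¹ * (k s + k t)) ≤ ∑' y, μ y * k y) {x : A} (hx : x ≠ 1) :
    (z * u).toReal / 2 * ((hitting μ z (x * s)).toReal + (hitting μ z (x * t)).toReal) ≤
      (hitting μ z x).toReal := by
  have hfin : ∀ y, hitting μ z y ≠ ∞ := fun y =>
    ne_top_of_le_ne_top ENNReal.one_ne_top (hitting_le_one hμ hz y)
  have h1 : z * (u * (2⁻¹ * (hitting μ z (x * s) + hitting μ z (x * t)))) ≤ hitting μ z x := by
    rw [← hitting_harmonic hx]
    exact mul_le_mul_right (h fun y => hitting μ z (x * y)) z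
  have h2 := ENNReal.toReal_mono (hfin x) h1
  rw [← mul_assoc, ENNReal.toReal_mul (a := z * u), ENNReal.toReal_mul (a := 2⁻¹),
    ENNReal.toReal_add (hfin _) (hfin _), ENNReal.toReal_inv, ENNReal.toReal_ofNat] at h2
  linarith

/-- With `f = F(s)` and `F(s²) ≥ f²`, one step from `s` gives `f ≥ (999/2000)(f² + 1)`. This nearly
reads `(1 - f)² ≤ 0`, which pushes `f` close to `1`. -/
theorem hitting_toReal_sq_ge (hμ : IsSymmetric μ) {z : ℝ≥0∞} (hz : z < 1) {u : ℝ≥0∞} {s : A}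
    (hs : s ≠ 1) (h : ∀ k : A → ℝ≥0∞, u * (2⁻¹ * (k s + k s⁻¹)) ≤ ∑' y, μ y * k y)
    (hu : 999 / 1000 ≤ (z * u).toReal) : 9 / 10 ≤ (hitting μ z s).toReal ^ 2 := by
  have hfin : ∀ y, hitting μ z y ≠ ∞ := fun y =>
    ne_top_of_le_ne_top ENNReal.one_ne_top (hitting_le_one hμ hz y)
  have h1 := hitting_ge_of_step hμ hz h hs
  have h2 := ENNReal.toReal_mono (hfin _) (hitting_sq_le hμ hz s)
  rw [ENNReal.toReal_pow] at h2
  rw [mul_inv_cancel, hitting_one hμ hz, ENNReal.toReal_one] at h1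
  have h3 := ENNReal.toReal_mono ENNReal.one_ne_top (hitting_le_one hμ hz s)
  rw [ENNReal.toReal_one] at h3
  have h0 : 0 ≤ (hitting μ z s).toReal := ENNReal.toReal_nonneg
  set f := (hitting μ z s).toReal
  have h4 : 999 / 2000 * (f ^ 2 + 1) ≤ f := by
    refine le_trans ?_ h1
    exact mul_le_mul (by linarith) (by linarith) (by positivity) (by positivity)
  have h5 : 95 / 100 ≤ f := by nlinarith
  nlinarith

/-- In exponent two, `1, s, t, s * t` form a Klein four-group on which the concentrated part of the
walk moves around a square. The three one-step inequalities at `s`, `t`, `s * t` close up and force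
`F(s) + F(t)` to be nearly `2`. -/
theorem hitting_add_toReal_ge_of_involutive (hμ : IsSymmetric μ) {z : ℝ≥0∞} (hz : z < 1)
    {u : ℝ≥0∞} {s t : A} (hinv : ∀ x : A, x * x = 1) (hs : s ≠ 1) (ht : t ≠ 1) (hst : s ≠ t)
    (h : ∀ k : A → ℝ≥0∞, u * (2⁻¹ * (k s + k t)) ≤ ∑' y, μ y * k y)
    (hu : 999 / 1000 ≤ (z * u).toReal) :
    13 / 10 ≤ (hitting μ z s).toReal ^ 2 + (hitting μ z t).toReal ^ 2 := by
  have hi : ∀ x : A, x⁻¹ = x := fun x => inv_eq_of_mul_eq_one_left (hinv x)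
  have hcomm : t * s = s * t := by
    have := hi (s * t)
    rwa [mul_inv_rev, hi, hi] at this
  have hst1 : s * t ≠ 1 := fun h => hst (by rw [mul_eq_one_iff_eq_inv.1 h, hi])
  have h1 := hitting_ge_of_step hμ hz h hs
  have h2 := hitting_ge_of_step hμ hz h ht
  have h3 := hitting_ge_of_step hμ hz h hst1
  rw [hinv, hitting_one hμ hz, ENNReal.toReal_one] at h1 h2
  rw [mul_assoc s t t, hinv, mul_one, mul_assoc, hcomm, ← mul_assoc, hinv, one_mul] at h3
  rw [hcomm] at h2
  have p1 : 0 ≤ (hitting μ z s).toReal := ENNReal.toReal_nonneg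
  have p2 : 0 ≤ (hitting μ z t).toReal := ENNReal.toReal_nonneg
  have p3 : 0 ≤ (hitting μ z (s * t)).toReal := ENNReal.toReal_nonneg
  set f := (hitting μ z s).toReal
  set f' := (hitting μ z t).toReal
  set g := (hitting μ z (s * t)).toReal
  have hr : 999 / 2000 ≤ (z * u).toReal / 2 := by linarith
  have h1' : 999 / 2000 * (1 + g) ≤ f := (mul_le_mul_of_nonneg_right hr (by positivity)).trans h1
  have h2' : 999 / 2000 * (g + 1) ≤ f' := (mul_le_mul_of_nonneg_right hr (by positivity)).trans h2
  have h3' : 999 / 2000 * (f' + f) ≤ g := (mul_le_mul_of_nonneg_right hr (by positivity)).trans h3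
  have hf : 19 / 10 ≤ f + f' := by linarith
  nlinarith [sq_nonneg (f - f')]

theorem hitting_sq_eq_ofReal (hμ : IsSymmetric μ) {z : ℝ≥0∞} (hz : z < 1) (s : A) :
    hitting μ z s ^ 2 = ENNReal.ofReal ((hitting μ z s).toReal ^ 2) := by
  rw [ENNReal.ofReal_pow ENNReal.toReal_nonneg, ENNReal.ofReal_toReal
    (ne_top_of_le_ne_top ENNReal.one_ne_top (hitting_le_one hμ hz s))]

theorem le_hittingSum_of_pair (hμ : IsSymmetric μ) {z : ℝ≥0∞} (hz : z < 1) {s t : A}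
    (hs : s ≠ 1) (ht : t ≠ 1) (hst : s ≠ t) :
    ENNReal.ofReal ((hitting μ z s).toReal ^ 2 + (hitting μ z t).toReal ^ 2) ≤
      hittingSum μ z := by
  classical
  rw [ENNReal.ofReal_add (by positivity) (by positivity), ← hitting_sq_eq_ofReal hμ hz,
    ← hitting_sq_eq_ofReal hμ hz]
  refine le_trans (le_of_eq ?_) (ENNReal.sum_le_tsum {s, t})
  rw [Finset.sum_pair hst, if_neg hs, if_neg ht]

variable (A) [Group.FG A]

theorem exists_hittingSum_ge_of_nontrivial [Nontrivial A] :
    ∃ μ : PMF A, IsFinitelySupported μ ∧ IsSymmetric μ ∧ IsAdmissible μ ∧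
      ∃ z < 1, ENNReal.ofReal (8 / 10) ≤ hittingSum μ z := by
  classical
  obtain ⟨s, hs⟩ := exists_ne (1 : A)
  set u : ℝ≥0∞ := ENNReal.ofReal (9999 / 10000) with hu
  have hu1 : u < 1 := by rw [hu, ENNReal.ofReal_lt_one]; norm_num
  have hu0 : u ≠ 0 := by rw [hu]; simp
  have huu : 999 / 1000 ≤ (u * u).toReal := by
    rw [ENNReal.toReal_mul, hu, ENNReal.toReal_ofReal (by norm_num)]; norm_num
  obtain ⟨μ, h1, h2, h3, h4⟩ := exists_concentrated (A := A) (add_tsub_cancel_of_le hu1.le) hu0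
    (tsub_pos_of_lt hu1).ne' (s := s) (Or.inl rfl)
  refine ⟨μ, h1, h2, h3, u, hu1, ?_⟩
  have h5 := hitting_toReal_sq_ge h2 hu1 hs h4 huu
  have h6 : hitting μ u s ^ 2 ≤ hittingSum μ u := by
    refine le_trans (le_of_eq ?_) (ENNReal.le_tsum s)
    rw [if_neg hs]
  refine le_trans ?_ h6
  rw [hitting_sq_eq_ofReal h2 hu1]
  exact ENNReal.ofReal_le_ofReal (by linarith)

theorem exists_hittingSum_ge_of_three {a b : A} (ha : a ≠ 1) (hb : b ≠ 1) (hab : a ≠ b) :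
    ∃ μ : PMF A, IsFinitelySupported μ ∧ IsSymmetric μ ∧ IsAdmissible μ ∧
      ∃ z < 1, ENNReal.ofReal (13 / 10) ≤ hittingSum μ z := by
  classical
  -- `u` serves both as the mass of the concentrated part and as the parameter `z`, hence the bound
  -- on `u * u`.
  set u : ℝ≥0∞ := ENNReal.ofReal (9999 / 10000) with hu
  have hu1 : u < 1 := by rw [hu, ENNReal.ofReal_lt_one]; norm_num
  have hu0 : u ≠ 0 := by rw [hu]; simp
  have huu : 999 / 1000 ≤ (u * u).toReal := by
    rw [ENNReal.toReal_mul, hu, ENNReal.toReal_ofReal (by norm_num)]; norm_num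
  -- If some `s` is not an involution, `s` and `s⁻¹` are two elements with the same large value;
  -- otherwise the given involutions `a`, `b` are used.
  by_cases hinv : ∀ x : A, x * x = 1
  · obtain ⟨μ, h1, h2, h3, h4⟩ := exists_concentrated (A := A) (add_tsub_cancel_of_le hu1.le) hu0
      (tsub_pos_of_lt hu1).ne' (s := a) (t := b)
      (Or.inr ⟨inv_eq_of_mul_eq_one_left (hinv a), inv_eq_of_mul_eq_one_left (hinv b)⟩)
    refine ⟨μ, h1, h2, h3, u, hu1, ?_⟩
    refine le_trans (ENNReal.ofReal_le_ofReal ?_) (le_hittingSum_of_pair h2 hu1 ha hb hab)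
    exact hitting_add_toReal_ge_of_involutive h2 hu1 hinv ha hb hab h4 huu
  · obtain ⟨s, hs⟩ := not_forall.1 hinv
    have hs1 : s ≠ 1 := by rintro rfl; simp at hs
    have hs2 : s ≠ s⁻¹ := fun h => hs (by nth_rewrite 2 [h]; simp)
    obtain ⟨μ, h1, h2, h3, h4⟩ := exists_concentrated (A := A) (add_tsub_cancel_of_le hu1.le) hu0
      (tsub_pos_of_lt hu1).ne' (s := s) (Or.inl rfl)
    refine ⟨μ, h1, h2, h3, u, hu1, ?_⟩
    refine le_trans (ENNReal.ofReal_le_ofReal ?_)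
      (le_hittingSum_of_pair h2 hu1 hs1 (inv_ne_one.2 hs1) hs2)
    rw [hitting_inv h2]
    linarith [hitting_toReal_sq_ge h2 hu1 hs1 h4 huu]

end Bounds

/-! ### Choice of coefficients and transfer to the binary free product -/

section Transfer

open Monoid

theorem tsum_pmf_map_mul {X Y : Type*} (p : PMF X) (φ : X → Y) (k : Y → ℝ≥0∞) :
    ∑' y, p.map φ y * k y = ∑' x, p x * k (φ x) := by
  classical
  simp_rw [PMF.map_apply, ← ENNReal.tsum_mul_right]
  rw [ENNReal.tsum_comm]
  refine tsum_congr fun x => ?_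
  rw [tsum_eq_single (φ x) fun y hy => by simp [hy]]
  simp

theorem IsSymmetric.map {A B : Type*} [Group A] [Group B] {p : PMF A} (hp : IsSymmetric p)
    (φ : A →* B) : IsSymmetric (p.map φ) := fun g => by
  classical
  rw [PMF.map_apply, PMF.map_apply, ← (Equiv.inv A).tsum_eq]
  refine tsum_congr fun a => ?_
  simp only [Equiv.inv_apply, map_inv, inv_inj, hp a]

theorem IsHarmonicWeight.comp {A B : Type*} [Group A] [Group B] {m F : A → ℝ≥0∞} {z U : ℝ≥0∞}
    (h : IsHarmonicWeight m F z U) (φ : B ≃* A) :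
    IsHarmonicWeight (fun b => m (φ b)) (fun b => F (φ b)) z U where
  tsum_eq_one := (φ.toEquiv.tsum_eq m).trans h.tsum_eq_one
  symm b := by rw [map_inv, h.symm]
  one := by rw [map_one, h.one]
  harmonic a ha := by
    have h1 := h.harmonic (φ a) (by simpa using ha)
    rw [← φ.toEquiv.tsum_eq] at h1
    simpa using h1
  defect := by
    have h1 := h.defect
    rw [← φ.toEquiv.tsum_eq] at h1
    exact h1
  tsum_ne_top := by
    have h1 := h.tsum_ne_top
    rw [← φ.toEquiv.tsum_eq] at h1
    exact h1

theorem hittingSum_comp {A B : Type*} [Group A] [Group B] [DecidableEq B] (μ : PMF A) (z : ℝ≥0∞)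
    (φ : B ≃* A) : ∑' b : B, (if b = 1 then 0 else hitting μ z (φ b) ^ 2) = hittingSum μ z := by
  rw [hittingSum, ← φ.toEquiv.tsum_eq]
  refine tsum_congr fun b => ?_
  by_cases hb : b = 1 <;> simp [hb]

theorem exists_coefficients {U z : Bool → ℝ≥0∞} (hU : ∀ i, U i < 1) (hz0 : ∀ i, z i ≠ 0)
    (hz : ∀ i, z i < 1) : ∃ (c α : Bool → ℝ≥0∞) (r₀ : ℝ≥0∞), r₀ ≠ 0 ∧ r₀ ≠ ∞ ∧
      α true + α false = 1 ∧ (∀ i, α i ≠ 0) ∧ (∀ i, r₀ * α i = c i * z i) ∧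
      (∀ i, c i + c (!i) * U (!i) = 1) ∧ ∀ i, c i * z i < c i := by
  have hUU : U true * U false < 1 := by
    have h : U true * U false ≤ 1 * U false := by gcongr; exact (hU true).le
    rw [one_mul] at h
    exact h.trans_lt (hU false)
  set D := 1 - U true * U false with hD
  have hD0 : D ≠ 0 := (tsub_pos_of_lt hUU).ne'
  have hDt : D ≠ ∞ := by finiteness
  -- The solution of the linear system `c i + c (!i) * U (!i) = 1`, whose determinant is `D`. Then
  -- `r₀` is forced by `α true + α false = 1`.
  set c : Bool → ℝ≥0∞ := fun i => (1 - U (!i)) / D with hc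
  have hc0 : ∀ i, c i ≠ 0 := fun i => (ENNReal.div_pos (tsub_pos_of_lt (hU _)).ne' hDt).ne'
  have hct : ∀ i, c i ≠ ∞ := fun i => ENNReal.div_ne_top (by finiteness) hD0
  have hcU : ∀ i, c i + c (!i) * U (!i) = 1 := fun i => by
    have hDi : D = 1 - U i * U (!i) := by cases i <;> simp [hD, mul_comm]
    have h1 : U i * U (!i) ≤ U (!i) := by
      calc U i * U (!i) ≤ 1 * U (!i) := by gcongr; exact (hU i).le
        _ = _ := one_mul _
    have h2 : (1 - U i) * U (!i) = U (!i) - U i * U (!i) := by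
      rw [ENNReal.sub_mul fun _ _ => (hU _).ne_top, one_mul]
    simp only [hc, Bool.not_not]
    rw [mul_comm, ← mul_div_assoc, ← ENNReal.add_div, mul_comm, h2,
      tsub_add_tsub_cancel (hU _).le h1, ← hDi, ENNReal.div_self hD0 hDt]
  set r₀ := c true * z true + c false * z false with hr
  have hr0 : r₀ ≠ 0 := fun h => mul_ne_zero (hc0 true) (hz0 true) (add_eq_zero.1 h).1
  have hrt : r₀ ≠ ∞ := ENNReal.add_ne_top.2
    ⟨ENNReal.mul_ne_top (hct _) (hz _).ne_top, ENNReal.mul_ne_top (hct _) (hz _).ne_top⟩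
  refine ⟨c, fun i => c i * z i / r₀, r₀, hr0, hrt, ?_, fun i => ?_, fun i => ?_, hcU,
    fun i => ?_⟩
  · rw [← ENNReal.add_div, ← hr, ENNReal.div_self hr0 hrt]
  · exact (ENNReal.div_pos (mul_ne_zero (hc0 i) (hz0 i)) hrt).ne'
  · exact ENNReal.mul_div_cancel hr0 hrt
  · calc c i * z i < c i * 1 := ENNReal.mul_lt_mul_right (hc0 i) (hct i) (hz i)
      _ = c i := mul_one _

universe u v

/-- The two factors of a free product as a family in a common universe. -/
def Factor (Γ₁ : Type u) (Γ₂ : Type v) : Bool → Type (max u v)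
  | true => ULift.{v} Γ₁
  | false => ULift.{u} Γ₂

variable {Γ₁ : Type u} {Γ₂ : Type v} [Group Γ₁] [Group Γ₂]

instance Factor.group : ∀ i, Group (Factor Γ₁ Γ₂ i)
  | true => inferInstanceAs (Group (ULift.{v} Γ₁))
  | false => inferInstanceAs (Group (ULift.{u} Γ₂))

/-- The first factor is `Γ₁`. -/
def Factor.equivLeft : Factor Γ₁ Γ₂ true ≃* Γ₁ := (MulEquiv.ulift : ULift.{v} Γ₁ ≃* Γ₁)

/-- The second factor is `Γ₂`. -/
def Factor.equivRight : Factor Γ₁ Γ₂ false ≃* Γ₂ := (MulEquiv.ulift : ULift.{u} Γ₂ ≃* Γ₂)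

/-- The inclusions of the factors into the binary free product. -/
def Factor.toCoprod : ∀ i, Factor Γ₁ Γ₂ i →* Coprod Γ₁ Γ₂
  | true => Coprod.inl.comp Factor.equivLeft.toMonoidHom
  | false => Coprod.inr.comp Factor.equivRight.toMonoidHom

variable (Γ₁ Γ₂) in
/-- The binary free product as an indexed free product. -/
def coprodEquiv : Coprod Γ₁ Γ₂ ≃* CoprodI (Factor Γ₁ Γ₂) :=
  MonoidHom.toMulEquiv
    (Coprod.lift
      ((CoprodI.of (i := true)).comp (Factor.equivLeft (Γ₁ := Γ₁) (Γ₂ := Γ₂)).symm.toMonoidHom)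
      ((CoprodI.of (i := false)).comp (Factor.equivRight (Γ₁ := Γ₁) (Γ₂ := Γ₂)).symm.toMonoidHom))
    (CoprodI.lift Factor.toCoprod)
    (by
      apply Coprod.hom_ext <;> ext x <;> simp [Factor.toCoprod])
    (by
      apply CoprodI.ext_hom
      rintro (_ | _) <;> ext x <;> simp [Factor.toCoprod])

theorem coprodEquiv_symm_of (i : Bool) (a : Factor Γ₁ Γ₂ i) :
    (coprodEquiv Γ₁ Γ₂).symm (CoprodI.of a) = Factor.toCoprod i a := by
  change CoprodI.lift Factor.toCoprod (CoprodI.of a) = _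
  rw [CoprodI.lift_of]

theorem isAdmissible_coprod {μ : PMF (Coprod Γ₁ Γ₂)} {μ₁ : PMF Γ₁} {μ₂ : PMF Γ₂}
    (h₁ : IsAdmissible μ₁) (h₂ : IsAdmissible μ₂)
    (hl : ∀ a ∈ μ₁.support, Coprod.inl a ∈ μ.support)
    (hr : ∀ b ∈ μ₂.support, Coprod.inr b ∈ μ.support) : IsAdmissible μ := by
  have h1 : ∀ a : Γ₁, Coprod.inl a ∈ Subsemigroup.closure μ.support := fun a => by
    have ha : a ∈ Subsemigroup.closure μ₁.support := by rw [h₁]; trivial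
    induction ha using Subsemigroup.closure_induction with
    | mem x hx => exact Subsemigroup.subset_closure (hl x hx)
    | mul x y _ _ hx hy => rw [map_mul]; exact mul_mem hx hy
  have h2 : ∀ a : Γ₂, Coprod.inr a ∈ Subsemigroup.closure μ.support := fun a => by
    have ha : a ∈ Subsemigroup.closure μ₂.support := by rw [h₂]; trivial
    induction ha using Subsemigroup.closure_induction with
    | mem x hx => exact Subsemigroup.subset_closure (hr x hx)
    | mul x y _ _ hx hy => rw [map_mul]; exact mul_mem hx hy
  rw [IsAdmissible, eq_top_iff]
  rintro x -
  induction x using Coprod.induction_on with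
  | inl a => exact h1 a
  | inr b => exact h2 b
  | mul x y hx hy => exact mul_mem hx hy

theorem exists_isSpectrallyNonDegenerate {μ₁ : PMF Γ₁} {μ₂ : PMF Γ₂}
    (hf₁ : IsFinitelySupported μ₁) (hs₁ : IsSymmetric μ₁) (ha₁ : IsAdmissible μ₁)
    (hf₂ : IsFinitelySupported μ₂) (hs₂ : IsSymmetric μ₂) (ha₂ : IsAdmissible μ₂)
    {z₁ z₂ : ℝ≥0∞} (hz₁0 : z₁ ≠ 0) (hz₁ : z₁ < 1) (hz₂0 : z₂ ≠ 0) (hz₂ : z₂ < 1)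
    (hA : hittingSum μ₁ z₁ * hittingSum μ₂ z₂ = 1) :
    ∃ μ : PMF (Coprod Γ₁ Γ₂),
      IsFinitelySupported μ ∧ IsSymmetric μ ∧ IsAdapted μ ∧ IsAdmissible μ ∧
      IsSpectrallyNonDegenerate μ (freeFactors Γ₁ Γ₂) := by
  classical
  let z : Bool → ℝ≥0∞ := fun i => bif i then z₁ else z₂
  let U : Bool → ℝ≥0∞ := fun i => bif i then returnGen μ₁ z₁ else returnGen μ₂ z₂
  let m : ∀ i, Factor Γ₁ Γ₂ i → ℝ≥0∞ := fun i => match i with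
    | true => fun a => μ₁ (Factor.equivLeft a)
    | false => fun a => μ₂ (Factor.equivRight a)
  let F : ∀ i, Factor Γ₁ Γ₂ i → ℝ≥0∞ := fun i => match i with
    | true => fun a => hitting μ₁ z₁ (Factor.equivLeft a)
    | false => fun a => hitting μ₂ z₂ (Factor.equivRight a)
  have h : ∀ i, IsHarmonicWeight (m i) (F i) (z i) (U i) := by
    rintro (_ | _)
    · exact (isHarmonicWeight_hitting hs₂ hz₂).comp Factor.equivRight
    · exact (isHarmonicWeight_hitting hs₁ hz₁).comp Factor.equivLeft
  obtain ⟨c, α, r₀, hr0, hrt, hα1, hα0, hα, hc, hlt⟩ := exists_coefficients (U := U) (z := z)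
    (by rintro (_ | _); exacts [returnGen_lt_one hs₂ hz₂, returnGen_lt_one hs₁ hz₁])
    (by rintro (_ | _); exacts [hz₂0, hz₁0]) (by rintro (_ | _); exacts [hz₂, hz₁])
  set μ : PMF (Coprod Γ₁ Γ₂) := pmfMix (α true) (α false) hα1
    (μ₁.map Coprod.inl) (μ₂.map Coprod.inr) with hμ
  have hsupp : μ.support = Coprod.inl '' μ₁.support ∪ Coprod.inr '' μ₂.support := by
    rw [hμ, support_pmfMix hα1 (hα0 _) (hα0 _), PMF.support_map, PMF.support_map]
  have hstep : ∀ (f : Coprod Γ₁ Γ₂ → ℝ≥0∞) (x : Coprod Γ₁ Γ₂), ∑' g, μ g * f (x * g) =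
      ∑ i, α i * ∑' a : Factor Γ₁ Γ₂ i, m i a *
        f (x * (coprodEquiv Γ₁ Γ₂).symm (CoprodI.of a)) := fun f x => by
    simp_rw [coprodEquiv_symm_of]
    rw [hμ, tsum_pmfMix_mul, tsum_pmf_map_mul, tsum_pmf_map_mul, Fintype.sum_bool,
      ← (Factor.equivLeft (Γ₂ := Γ₂)).toEquiv.tsum_eq fun a => μ₁ a * f (x * Coprod.inl a),
      ← (Factor.equivRight (Γ₁ := Γ₁)).toEquiv.tsum_eq fun a => μ₂ a * f (x * Coprod.inr a)]
    rfl
  have hsym : IsSymmetric μ := fun g => by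
    change α true * μ₁.map Coprod.inl g⁻¹ + α false * μ₂.map Coprod.inr g⁻¹ =
      α true * μ₁.map Coprod.inl g + α false * μ₂.map Coprod.inr g
    rw [hs₁.map, hs₂.map]
  have hA' : (∑' a : Factor Γ₁ Γ₂ true, if a = 1 then 0 else F true a ^ 2) *
      (∑' a : Factor Γ₁ Γ₂ false, if a = 1 then 0 else F false a ^ 2) = 1 := by
    rw [← hA, ← hittingSum_comp μ₁ z₁ (Factor.equivLeft (Γ₂ := Γ₂)),
      ← hittingSum_comp μ₂ z₂ (Factor.equivRight (Γ₁ := Γ₁))]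
  have hR : walkR μ ≤ r₀ :=
    walkR_le_core (coprodEquiv Γ₁ Γ₂) hsym h hstep hα hc hr0 hrt hA'
  refine ⟨μ, ?_, hsym, ⟨α true, α false, μ₁, μ₂, hf₁, ha₁, hs₁, hf₂, ha₂, hs₂, hα1,
    fun g => rfl⟩, ?_, ?_⟩
  · rw [IsFinitelySupported, hsupp]
    exact (hf₁.image _).union (hf₂.image _)
  · refine isAdmissible_coprod ha₁ ha₂ (fun a ha => ?_) fun b hb => ?_
    · rw [hsupp]; exact Or.inl ⟨a, ha, rfl⟩
    · rw [hsupp]; exact Or.inr ⟨b, hb, rfl⟩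
  · rintro H (rfl | rfl)
    · refine not_degenerate_factor (coprodEquiv Γ₁ Γ₂) h hstep hα hc hlt hR true _ fun x => ?_
      simp_rw [coprodEquiv_symm_of]
      exact ⟨fun ⟨a, ha⟩ => ⟨Factor.equivLeft.symm a, ha.symm.trans (by simp [Factor.toCoprod])⟩,
        fun ⟨a, ha⟩ => ⟨Factor.equivLeft a, ha.symm⟩⟩
    · refine not_degenerate_factor (coprodEquiv Γ₁ Γ₂) h hstep hα hc hlt hR false _ fun x => ?_
      simp_rw [coprodEquiv_symm_of]
      exact ⟨fun ⟨a, ha⟩ => ⟨Factor.equivRight.symm a, ha.symm.trans (by simp [Factor.toCoprod])⟩,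
        fun ⟨a, ha⟩ => ⟨Factor.equivRight a, ha.symm⟩⟩

theorem exists_pair_of_card_ne_two {A : Type*} [Group A] [Nontrivial A] (h : Nat.card A ≠ 2) :
    ∃ a b : A, a ≠ 1 ∧ b ≠ 1 ∧ a ≠ b := by
  obtain ⟨a, ha⟩ := exists_ne (1 : A)
  by_contra! hcon
  exact h (Nat.card_eq_two_iff.2 ⟨a, 1, ha, Set.eq_univ_of_forall fun b => by
    by_contra hb
    simp only [Set.mem_insert_iff, Set.mem_singleton_iff, not_or] at hb
    exact hb.1 (hcon a b ha hb.2).symm⟩)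

end Transfer

theorem exists_measure_of_isNonElementary {Γ₁ Γ₂ : Type*} [Group Γ₁] [Group Γ₂] [Group.FG Γ₁]
    [Group.FG Γ₂] (hne : IsNonElementaryFreeProduct Γ₁ Γ₂) :
    ∃ μ : PMF (Monoid.Coprod Γ₁ Γ₂),
      IsFinitelySupported μ ∧ IsSymmetric μ ∧ IsAdapted μ ∧ IsAdmissible μ ∧
      IsSpectrallyNonDegenerate μ (freeFactors Γ₁ Γ₂) := by
  obtain ⟨hn₁, hn₂, hcard⟩ := hne
  have h13 : ENNReal.ofReal (13 / 10) ≠ 0 := by simp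
  have h10 : ENNReal.ofReal (10 / 13) ≠ 0 := by simp
  -- The targets `13/10` and `10/13` are reciprocal, and the second is within reach of every
  -- non-trivial factor.
  have hle : ENNReal.ofReal (10 / 13) ≤ ENNReal.ofReal (8 / 10) :=
    ENNReal.ofReal_le_ofReal (by norm_num)
  have hmul : ENNReal.ofReal (13 / 10) * ENNReal.ofReal (10 / 13) = 1 := by
    rw [← ENNReal.ofReal_mul (by norm_num)]; norm_num
  by_cases h₁ : Nat.card Γ₁ = 2
  · obtain ⟨a, b, ha, hb, hab⟩ := exists_pair_of_card_ne_two fun h₂ => hcard ⟨h₁, h₂⟩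
    obtain ⟨μ₁, hf₁, hs₁, ha₁, z₁, hz₁, hA₁⟩ := exists_hittingSum_ge_of_nontrivial Γ₁
    obtain ⟨μ₂, hf₂, hs₂, ha₂, z₂, hz₂, hA₂⟩ := exists_hittingSum_ge_of_three Γ₂ ha hb hab
    obtain ⟨w₁, hw₁0, hw₁, hB₁⟩ :=
      exists_hittingSum_eq hs₁ hz₁ h10 ENNReal.ofReal_ne_top (hle.trans hA₁)
    obtain ⟨w₂, hw₂0, hw₂, hB₂⟩ := exists_hittingSum_eq hs₂ hz₂ h13 ENNReal.ofReal_ne_top hA₂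
    exact exists_isSpectrallyNonDegenerate hf₁ hs₁ ha₁ hf₂ hs₂ ha₂ hw₁0 hw₁ hw₂0 hw₂
      (by rw [hB₁, hB₂, mul_comm, hmul])
  · obtain ⟨a, b, ha, hb, hab⟩ := exists_pair_of_card_ne_two h₁
    obtain ⟨μ₁, hf₁, hs₁, ha₁, z₁, hz₁, hA₁⟩ := exists_hittingSum_ge_of_three Γ₁ ha hb hab
    obtain ⟨μ₂, hf₂, hs₂, ha₂, z₂, hz₂, hA₂⟩ := exists_hittingSum_ge_of_nontrivial Γ₂
    obtain ⟨w₁, hw₁0, hw₁, hB₁⟩ := exists_hittingSum_eq hs₁ hz₁ h13 ENNReal.ofReal_ne_top hA₁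
    obtain ⟨w₂, hw₂0, hw₂, hB₂⟩ :=
      exists_hittingSum_eq hs₂ hz₂ h10 ENNReal.ofReal_ne_top (hle.trans hA₂)
    exact exists_isSpectrallyNonDegenerate hf₁ hs₁ ha₁ hf₂ hs₂ ha₂ hw₁0 hw₁ hw₂0 hw₂
      (by rw [hB₁, hB₂, hmul])

end RatioLimit

end

theorem mainTheorem11 {Γ₁ Γ₂ : Type*} [Group Γ₁] [Group Γ₂] [Group.FG Γ₁] [Group.FG Γ₂]
    (hne : RatioLimit.IsNonElementaryFreeProduct Γ₁ Γ₂) :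
    ∃ μ : PMF (Monoid.Coprod Γ₁ Γ₂),
      RatioLimit.IsFinitelySupported μ ∧ RatioLimit.IsSymmetric μ ∧
      RatioLimit.IsAdapted μ ∧ RatioLimit.IsAdmissible μ ∧
      RatioLimit.IsSpectrallyNonDegenerate μ (RatioLimit.freeFactors Γ₁ Γ₂) := by
  exact RatioLimit.exists_measure_of_isNonElementary hne
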